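/- Let $b>1$. On $\mathfrak{so}(4)^*\cong\mathbb{R}^6$ with coordinates $\boldsymbol L=(\ell_{12},\ell_{13},\ell_{14},\ell_{23},\ell_{24},\ell_{34})$ consider the Lie–Poisson bracket $\{f,g\}=(\nabla f)^T B_{\boldsymbol L}\nabla g$ with structure matrix $$B_{\boldsymbol L}=\begin{pmatrix}0&\ell_{23}&\ell_{24}&-\ell_{13}&-\ell_{14}&0\\-\ell_{23}&0&\ell_{34}&\ell_{12}&0&-\ell_{14}\\-\ell_{24}&-\ell_{34}&0&0&\ell_{12}&\ell_{13}\\ \ell_{13}&-\ell_{12}&0&0&\ell_{34}&-\ell_{24}\\ \ell_{14}&0&-\ell_{12}&-\ell_{34}&0&\ell_{23}\\0&\ell_{14}&-\ell_{13}&\ell_{24}&-\ell_{23}&0\end{pmatrix},$$ and its symplectic leaf $$M=\Big\{\textstyle\sum_{i<j}\ell_{ij}^2=1,\ \ \ell_{12}\ell_{34}-\ell_{13}\ell_{24}+\ell_{14}\ell_{23}=0\Big\}=\{|\boldsymbol X|=|\boldsymbol Y|=\tfrac12\}\cong S^2\times S^2,$$ where $\boldsymbol X=\frac12(\ell_{12}+\ell_{34},\ell_{13}-\ell_{24},\ell_{14}+\ell_{23})$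 and $\boldsymbol Y=\frac12(\ell_{12}-\ell_{34},-\ell_{13}-\ell_{24},\ell_{14}-\ell_{23})$. Let $G_{pro}=b\ell_{12}^2+b\ell_{13}^2+\ell_{14}^2$. The reduced prolate system is the pair $(\ell_{23},G_{pro})$ on $M$. Then: 1. $\ell_{23}$ generates a global $S^1$ action on $M$: its Hamiltonian flow on $M$ is the flow of a continuous effective action of the circle $\mathbb R/2\pi\mathbb Z$. 2. Every singular point of $(\ell_{23},G_{pro}):M\to\mathbb R^2$ is non-degenerate, and is either of purely elliptic type (elliptic–regular or elliptic–elliptic) or a focus-focus point. 3. The set of values of $(\ell_{23},G_{pro})$ at focus-focus points is exactly $\{(0,1)\}$, and the fibre $\{p\in M:(\ell_{23},G_{pro})(p)=(0,1)\}$ is a doubly pinched torus: it is homeomorphic to the quotient of $S^1\times S^1$ obtained by collapsing each of the two circles $\{1\}\times S^1$ and $\{-1\}\times S^1$ to a point, by a homeomorphism under which the two pinch points correspond to the focus-focus points. 4. Hence $(\ell_{23},G_{pro})$ is a generalised semi-toric system on $M$. That is, $M$ is a connected symplectic four-manifold; $\ell_{23}$ and $G_{pro}$ are smooth, Poisson-commute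 on $M$ and have linearly independent differentials almost everywhere on $M$; $\ell_{23}$ is proper on $M$ and generates a global effective $S^1$ action; and all singular points are non-degenerate with only elliptic and focus-focus components (several focus-focus points may lie in one level set). Here a singular point $p$ is a point where the rank $r$ of the differential of $(J,H)=(\ell_{23},G_{pro})$ on $T_pM$ is less than $2$. Put $K=\ker dJ\cap\ker dH\subset T_pM$ and $L=\mathrm{span}(X_J,X_H)(p)\subset K$, where $X_f=B_{\boldsymbol L}\nabla f$. For each combination $f=sJ+tH$ with $X_f(p)=0$, the linearisation of $X_f$ at $p$ induces an operator on the $(4-2r)$-dimensional space $K/L$. The point $p$ is non-degenerate if these operators form a space of dimension $2-r$ and one of them, called regular, has $4-2r$ distinct complex eigenvalues. It is of elliptic type if the eigenvalues of a regular operator are purely imaginary, and focus-focus if $r=0$ and the eigenvalues of a regular operator are $\pm\alpha\pm i\beta$ with $\alpha,\beta\neq0$ real. -/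

import Mathlib

open scoped ContDiff

/-! ## Integrable systems with two degrees of freedom on symplectic submanifolds of a Poisson space

A Poisson structure on `ℝⁿ` is given by its structure matrix `B`, so that
`{f, g} = (∇f)ᵀ B ∇g` and the Hamiltonian vector field of `f` is `B ∇f`. -/

namespace PoissonSystem

/-- The space `ℝⁿ` with its Euclidean inner product. -/
abbrev Vec (n : ℕ) : Type := EuclideanSpace ℝ (Fin n)

/-- A field of `n × n` matrices on `ℝⁿ`. -/
abbrev MatField (n : ℕ) : Type := Vec n → Matrix (Fin n) (Fin n) ℝ

/-- The Hamiltonian vector field `X_f = B ∇f`. -/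
noncomputable def hamVF {n : ℕ} (B : MatField n) (f : Vec n → ℝ) (p : Vec n) : Vec n :=
  Matrix.toEuclideanLin (B p) (gradient f p)

/-- The bracket `{f, g} = (∇f)ᵀ B ∇g`. -/
noncomputable def bracket {n : ℕ} (B : MatField n) (f g : Vec n → ℝ) (p : Vec n) : ℝ :=
  inner ℝ (gradient f p) (hamVF B g p)

/-- `B` is the structure matrix of a smooth Poisson bracket: it is smooth and antisymmetric, and
the Jacobi identity `{xᵢ, {xⱼ, xₖ}} + {xⱼ, {xₖ, xᵢ}} + {xₖ, {xᵢ, xⱼ}} = 0` holds for the coordinate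
functions, for which `{xⱼ, xₖ} = Bⱼₖ`. -/
structure IsPoisson {n : ℕ} (B : MatField n) : Prop where
  smooth : ∀ i j, ContDiff ℝ ∞ (fun p => B p i j)
  antisymm : ∀ p i j, B p i j = - B p j i
  jacobi : ∀ p i j k,
    bracket B (fun q => q i) (fun q => B q j k) p
      + bracket B (fun q => q j) (fun q => B q k i) p
      + bracket B (fun q => q k) (fun q => B q i j) p = 0

/-- The characteristic subspace `{X_f(p)} = range B(p)`. -/
noncomputable def charSpace {n : ℕ} (B : MatField n) (p : Vec n) : Submodule ℝ (Vec n) :=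
  LinearMap.range (Matrix.toEuclideanLin (B p))

/-- `M` is a connected embedded submanifold of dimension `d` whose tangent space at each point `p`
is the characteristic subspace at `p`; thus the Poisson structure makes `M` a symplectic manifold,
with `ω(X_f, X_g) = {f, g}`. -/
structure IsSymplecticManifold {n : ℕ} (B : MatField n) (M : Set (Vec n)) (d : ℕ) : Prop where
  poisson : IsPoisson B
  connected : IsConnected M
  submanifold : ∀ p ∈ M, ∃ k : ℕ, k + d = n ∧ ∃ U : Set (Vec n), IsOpen U ∧ p ∈ U ∧
    ∃ Φ : Vec n → Vec k, ContDiffOn ℝ ∞ Φ U ∧ M ∩ U = {q ∈ U | Φ q = 0} ∧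
      Function.Surjective (fderiv ℝ Φ p) ∧
      LinearMap.ker (fderiv ℝ Φ p : Vec n →ₗ[ℝ] Vec k) = charSpace B p

/-- `f` generates a global circle action on `M`: there is an effective continuous action of the
circle group on `M` whose orbits `t ↦ exp(it) • p` are the integral curves of `X_f`; that is, the
Hamiltonian flow of `f` on `M` is complete and periodic with minimal common period `2π`. -/
def GeneratesCircleAction {n : ℕ} (B : MatField n) (M : Set (Vec n)) (f : Vec n → ℝ) : Prop :=
  ∃ φ : Circle → M → M,
    Continuous (fun q : Circle × M => φ q.1 q.2) ∧
    (∀ p, φ 1 p = p) ∧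
    (∀ z w p, φ (z * w) p = φ z (φ w p)) ∧
    (∀ z, (∀ p, φ z p = p) → z = 1) ∧
    ∀ (p : M) (t : ℝ), HasDerivAt (fun s : ℝ => (φ (Circle.exp s) p : Vec n))
      (hamVF B f (φ (Circle.exp t) p)) t

section Singularities

variable {n : ℕ} (B : MatField n) (J H : Vec n → ℝ) (p : Vec n)

/-- The span `L` of the Hamiltonian vector fields of `J` and `H` at `p`. -/
noncomputable def orbitSpace : Submodule ℝ (Vec n) :=
  Submodule.span ℝ {hamVF B J p, hamVF B H p}

/-- The rank at `p` of the differential of the momentum map `(J, H)` on the symplectic manifold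
through `p`, which is the dimension of the span of the two Hamiltonian vector fields. -/
noncomputable def rank : ℕ := Module.finrank ℝ (orbitSpace B J H p)

/-- The common kernel `K` of `dJ` and `dH` in the tangent space at `p` of the symplectic manifold
through `p`. It is the symplectic orthogonal complement of `L`. -/
noncomputable def commonKernel : Submodule ℝ (Vec n) :=
  charSpace B p ⊓ LinearMap.ker (fderiv ℝ J p : Vec n →ₗ[ℝ] ℝ)
    ⊓ LinearMap.ker (fderiv ℝ H p : Vec n →ₗ[ℝ] ℝ)

/-- The combination `s J + t H`. -/
def comb (s t : ℝ) : Vec n → ℝ := fun q => s * J q + t * H q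

/-- The linearisation at `p` of the Hamiltonian vector field of `s J + t H`. It is used only where
that vector field vanishes at `p`; on the tangent space of the symplectic manifold it is then
`ω⁻¹ d²(s J + t H)`. -/
noncomputable def linearisation (s t : ℝ) : Vec n →L[ℝ] Vec n :=
  fderiv ℝ (hamVF B (comb J H s t)) p

/-- `z` is a complex eigenvalue, with eigenvector the class of `u + i v`, of the operator induced
on `K / L` by the linearisation of the Hamiltonian vector field of `s J + t H` at `p`. -/
def IsTransverseEigenvalue (s t : ℝ) (z : ℂ) : Prop :=
  ∃ u ∈ commonKernel B J H p, ∃ v ∈ commonKernel B J H p,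
    ¬ (u ∈ orbitSpace B J H p ∧ v ∈ orbitSpace B J H p) ∧
    linearisation B J H p s t u - (z.re • u - z.im • v) ∈ orbitSpace B J H p ∧
    linearisation B J H p s t v - (z.im • u + z.re • v) ∈ orbitSpace B J H p

/-- `s J + t H` is regular at `p`: `p` is a critical point of it, and the operator it induces on
`K / L`, a space of dimension `4 - 2 * rank`, has that many distinct eigenvalues. -/
def IsRegularComb (s t : ℝ) : Prop :=
  hamVF B (comb J H s t) p = 0 ∧
    {z : ℂ | IsTransverseEigenvalue B J H p s t z}.encard + 2 * (rank B J H p : ℕ∞) = 4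

/-- The point `p` is non-degenerate for `(J, H)` on the four-dimensional symplectic manifold through
`p`: the operators induced on `K / L` by the combinations `s J + t H` that are critical at `p` form
a Cartan subalgebra of the symplectic Lie algebra of `K / L`, that is, they have the full dimension
`2 - rank`, and among them there is one with simple spectrum. -/
def IsNondegenerate : Prop :=
  (∀ s t : ℝ, hamVF B (comb J H s t) p = 0 →
    (∀ u ∈ commonKernel B J H p, linearisation B J H p s t u ∈ orbitSpace B J H p) →
      s = 0 ∧ t = 0) ∧
  ∃ s t : ℝ, IsRegularComb B J H p s t

/-- `p` is a singular point of the momentum map `(J, H)`. -/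
def IsSingular : Prop := rank B J H p < 2

/-- `p` is a non-degenerate singular point with only elliptic components (elliptic-regular if the
rank is one, elliptic-elliptic if it is zero): the eigenvalues of a regular combination are purely
imaginary. -/
def IsEllipticPoint : Prop :=
  IsSingular B J H p ∧ IsNondegenerate B J H p ∧
    ∃ s t : ℝ, IsRegularComb B J H p s t ∧
      ∀ z : ℂ, IsTransverseEigenvalue B J H p s t z → z.re = 0

/-- `p` is a focus-focus point: a non-degenerate singular point of rank zero where the eigenvalues
of a regular combination are `±α ± iβ` with `α, β ≠ 0`. -/
def IsFocusFocusPoint : Prop :=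
  rank B J H p = 0 ∧ IsNondegenerate B J H p ∧
    ∃ s t : ℝ, IsRegularComb B J H p s t ∧ ∃ α β : ℝ, α ≠ 0 ∧ β ≠ 0 ∧
      ∀ z : ℂ, IsTransverseEigenvalue B J H p s t z ↔
        (z.re = α ∨ z.re = -α) ∧ (z.im = β ∨ z.im = -β)

end Singularities

/-- `(J, H)` is a Liouville integrable system on the symplectic four-manifold `M`: `J` and `H` are
smooth, commute on `M`, and have independent differentials almost everywhere on `M` (with respect
to the four-dimensional Hausdorff measure, whose null sets in `M` are those of the Liouville
volume). -/
structure IsIntegrableSystem {n : ℕ} (B : MatField n) (M : Set (Vec n)) (J H : Vec n → ℝ) :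
    Prop where
  symplectic : IsSymplecticManifold B M 4
  smooth_J : ContDiff ℝ ∞ J
  smooth_H : ContDiff ℝ ∞ H
  commute : ∀ p ∈ M, bracket B J H p = 0
  independent : MeasureTheory.Measure.hausdorffMeasure (4 : ℝ) {p ∈ M | IsSingular B J H p} = 0

/-- `(J, H)` is a generalised semi-toric system on the connected symplectic four-manifold `M`: it is
an integrable system, `J` is proper and generates a global effective circle action, and all singular
points of `(J, H)` are non-degenerate with elliptic and focus-focus components only. The word
`generalised` refers to the fact that several focus-focus points may share a level set. -/
structure IsGeneralisedSemitoric {n : ℕ} (B : MatField n) (M : Set (Vec n)) (J H : Vec n → ℝ) :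
    Prop where
  integrable : IsIntegrableSystem B M J H
  proper : ∀ C : Set ℝ, IsCompact C → IsCompact (M ∩ J ⁻¹' C)
  circleAction : GeneratesCircleAction B M J
  singularities : ∀ p ∈ M, IsSingular B J H p →
    IsNondegenerate B J H p ∧ (IsEllipticPoint B J H p ∨ IsFocusFocusPoint B J H p)

/-- The equivalence relation on the torus `S¹ × S¹` which collapses each of the two parallel circles
`{1} × S¹` and `{-1} × S¹` to a point. -/
def pinchSetoid : Setoid (Circle × Circle) where
  r x y := x = y ∨ (x.1 = y.1 ∧ x.1 ^ 2 = 1)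
  iseqv :=
    { refl := fun _ => Or.inl rfl
      symm := by
        rintro x y (h | ⟨h, h'⟩)
        · exact Or.inl h.symm
        · exact Or.inr ⟨h.symm, h ▸ h'⟩
      trans := by
        rintro x y z (h | ⟨h, h'⟩) (k | ⟨k, k'⟩)
        · exact Or.inl (h.trans k)
        · exact Or.inr ⟨h ▸ k, h ▸ k'⟩
        · exact Or.inr ⟨k ▸ h, h'⟩
        · exact Or.inr ⟨h.trans k, h'⟩ }

/-- The doubly pinched torus, with the quotient topology. -/
abbrev DoublyPinchedTorus : Type := Quotient pinchSetoid

/-- The two pinch points of the doubly pinched torus. -/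
def pinchPoints : Set DoublyPinchedTorus :=
  {x | ∃ z w : Circle, z ^ 2 = 1 ∧ x = Quotient.mk pinchSetoid (z, w)}

end PoissonSystem

/-! ## The reduced prolate system

Coordinates on `so(4)* = ℝ⁶` are `L = (ℓ₁₂, ℓ₁₃, ℓ₁₄, ℓ₂₃, ℓ₂₄, ℓ₃₄)`, with indices `0, …, 5`. -/

namespace Prolate

open PoissonSystem

/-- The structure matrix of the Lie-Poisson bracket of `so(4)*`. -/
def structureMatrix : MatField 6 := fun L =>
  !![    0,  L 3,  L 4, -L 1, -L 2,    0;
      -L 3,    0,  L 5,  L 0,    0, -L 2;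
      -L 4, -L 5,    0,    0,  L 0,  L 1;
       L 1, -L 0,    0,    0,  L 5, -L 4;
       L 2,    0, -L 0, -L 5,    0,  L 3;
         0,  L 2, -L 1,  L 4, -L 3,    0]

/-- The vector `X = ½ (ℓ₁₂ + ℓ₃₄, ℓ₁₃ - ℓ₂₄, ℓ₁₄ + ℓ₂₃)`. -/
noncomputable def vecX (L : Vec 6) : Vec 3 :=
  !₂[(L 0 + L 5) / 2, (L 1 - L 4) / 2, (L 2 + L 3) / 2]

/-- The vector `Y = ½ (ℓ₁₂ - ℓ₃₄, -ℓ₁₃ - ℓ₂₄, ℓ₁₄ - ℓ₂₃)`. -/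
noncomputable def vecY (L : Vec 6) : Vec 3 :=
  !₂[(L 0 - L 5) / 2, -(L 1 + L 4) / 2, (L 2 - L 3) / 2]

/-- The reduced phase space `S² × S²` at energy `2h = 1`: the product of the spheres
`|X|² = |Y|² = h/2 = 1/4` in the linear coordinates `(X, Y)` on `ℝ⁶`. -/
def phaseSpace : Set (Vec 6) :=
  {L | vecX L ∈ Metric.sphere (0 : Vec 3) (1 / 2) ∧ vecY L ∈ Metric.sphere (0 : Vec 3) (1 / 2)}

/-- The reduced phase space is the level set `∑ ℓᵢⱼ² = 2h = 1`,
`ℓ₁₂ ℓ₃₄ - ℓ₁₃ ℓ₂₄ + ℓ₁₄ ℓ₂₃ = 0` of the two Casimirs. -/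
theorem mem_phaseSpace_iff (L : Vec 6) :
    L ∈ phaseSpace ↔
      L 0 ^ 2 + L 1 ^ 2 + L 2 ^ 2 + L 3 ^ 2 + L 4 ^ 2 + L 5 ^ 2 = 1 ∧
        L 0 * L 5 - L 1 * L 4 + L 2 * L 3 = 0 := by
  have key : ∀ v : Vec 3, v ∈ Metric.sphere (0 : Vec 3) (1 / 2) ↔
      v 0 ^ 2 + v 1 ^ 2 + v 2 ^ 2 = 1 / 4 := by
    intro v
    rw [mem_sphere_zero_iff_norm, ← sq_eq_sq₀ (norm_nonneg v) (by norm_num),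
      EuclideanSpace.real_norm_sq_eq, Fin.sum_univ_three]
    norm_num
  simp only [phaseSpace, Set.mem_ofPred_eq, key]
  simp [vecX, vecY]
  constructor
  · rintro ⟨h1, h2⟩
    constructor <;> nlinarith
  · rintro ⟨h1, h2⟩
    constructor <;> nlinarith

/-- The integral `ℓ₂₃`. -/
def ell23 (L : Vec 6) : ℝ := L 3

/-- The integral `G_pro = b ℓ₁₂² + b ℓ₁₃² + ℓ₁₄²`. -/
def gPro (b : ℝ) (L : Vec 6) : ℝ := b * L 0 ^ 2 + b * L 1 ^ 2 + L 2 ^ 2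

end Prolate

/-! In the coordinates `u = ℓ₁₂ + i ℓ₁₃`, `w = ℓ₂₄ + i ℓ₃₄`, `x = ℓ₁₄`, `y = ℓ₂₃`, the flow of `ℓ₂₃`
rotates `u` and `w` simultaneously, and `G_pro = b |u|² + x²`. Pairing the equation
`X_G = c X_J` with `u` and `w` and adding up squares shows that a singular point has
`u = w = 0`, `u = x = 0` or `x = w = 0`. At a fixed point `u = w = 0` one has `xy = 0`, and the
linearisations act on `(δu, δw)` by a complex `2 × 2` matrix, which is diagonal with imaginary
entries if `x = 0` and has the eigenvalues `i s ± 2 t x √(b - 1)` if `y = 0`. At the other singular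
points they reduce to a harmonic oscillator. The fibre over `(0, 1)` is given by `y = 0`,
`b |u|² + x² = 1` and `w = ± √(b - 1) u`: as `(x, ± √b |u|)` runs through a circle, the common
direction of `u` and `w` runs through another one, and it is lost exactly where `u = 0`. -/

open MeasureTheory Measure Module
open scoped NNReal ComplexConjugate

theorem fderiv_apply_eq_of_forall_add_smul {𝕜 E F : Type*} [NontriviallyNormedField 𝕜]
    [NormedAddCommGroup E] [NormedSpace 𝕜 E] [NormedAddCommGroup F] [NormedSpace 𝕜 F]
    {f : E → F} {x v : E} {a q : F} (hf : DifferentiableAt 𝕜 f x)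
    (h : ∀ τ : 𝕜, f (x + τ • v) = f x + τ • a + τ ^ 2 • q) : fderiv 𝕜 f x v = a := by
  have hquad : HasLineDerivAt 𝕜 f a x v := by
    have hτ := hasDerivAt_id (0 : 𝕜)
    simpa [HasLineDerivAt, h] using
      ((hτ.smul_const a).const_add (f x)).fun_add ((hτ.pow 2).smul_const q)
  exact (hf.hasFDerivAt.hasLineDerivAt v).unique hquad

theorem fderiv_fderiv_apply_eq_zero {𝕜 E F : Type*} [NontriviallyNormedField 𝕜]
    [NormedAddCommGroup E] [NormedSpace 𝕜 E] [NormedAddCommGroup F] [NormedSpace 𝕜 F]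
    {f : E → F} {X : E → E} {p : E} (hf : DifferentiableAt 𝕜 (fderiv 𝕜 f) p)
    (hX : DifferentiableAt 𝕜 X p) (h : ∀ q, fderiv 𝕜 f q (X q) = 0) (hp : X p = 0) (v : E) :
    fderiv 𝕜 f p (fderiv 𝕜 X p v) = 0 := by
  have hderiv := (hf.hasFDerivAt.clm_apply hX.hasFDerivAt).fderiv
  simp only [h, hp] at hderiv
  simpa using (congrArg (· v) hderiv).symm

theorem hausdorffMeasure_range_eq_zero_of_finrank_lt {E F : Type*} [NormedAddCommGroup E]
    [NormedSpace ℝ E] [FiniteDimensional ℝ E] [NormedAddCommGroup F] [NormedSpace ℝ F]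
    [MeasurableSpace F] [BorelSpace F] {f : E → F} (hf : ContDiff ℝ 1 f) {d : ℝ≥0}
    (hd : finrank ℝ E < d) : μH[d] (Set.range f) = 0 :=
  hausdorffMeasure_of_dimH_lt (hf.dimH_range_le.trans_lt (by exact_mod_cast hd))

namespace PoissonSystem

variable {n : ℕ}

theorem gradient_eq_iff_forall_fderiv {f : Vec n → ℝ} {p a : Vec n} :
    gradient f p = a ↔ ∀ v, fderiv ℝ f p v = inner ℝ a v := by
  refine ⟨fun h v => ?_, fun h => ext_inner_right ℝ fun v => ?_⟩
  · rw [← h, inner_gradient_left]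
  · rw [inner_gradient_left, h]

theorem bracket_eq_fderiv (B : MatField n) (f g : Vec n → ℝ) (p : Vec n) :
    bracket B f g p = fderiv ℝ f p (hamVF B g p) :=
  inner_gradient_left

theorem comb_one_zero (J H : Vec n → ℝ) : comb J H 1 0 = J := by
  funext q
  simp [comb]

theorem comb_zero_one (J H : Vec n → ℝ) : comb J H 0 1 = H := by
  funext q
  simp [comb]

section LiePoisson

variable {B : MatField n} {c : Fin n → Fin n → Fin n → ℝ}

theorem fderiv_coord (i : Fin n) (p v : Vec n) : fderiv ℝ (fun q : Vec n => q i) p v = v i :=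
  congrArg (· v) (EuclideanSpace.proj (𝕜 := ℝ) i).fderiv

theorem gradient_eq_of_structureConstants (hB : ∀ p j k, B p j k = ∑ m, c m j k * p m)
    (p : Vec n) (j k : Fin n) :
    gradient (fun q => B q j k) p = WithLp.toLp 2 (c · j k) := by
  refine gradient_eq_iff_forall_fderiv.2 fun v => ?_
  have hlin : (fun q => B q j k) = innerSL ℝ (WithLp.toLp 2 (c · j k) : Vec n) := by
    funext q
    simp [hB, PiLp.inner_apply, mul_comm]
  rw [hlin, ContinuousLinearMap.fderiv, innerSL_apply_apply]

theorem bracket_coord_of_structureConstants (hB : ∀ p j k, B p j k = ∑ m, c m j k * p m)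
    (p : Vec n) (i j k : Fin n) :
    bracket B (fun q => q i) (fun q => B q j k) p = ∑ m, (∑ l, c m i l * c l j k) * p m := by
  rw [bracket_eq_fderiv, fderiv_coord, hamVF, gradient_eq_of_structureConstants hB]
  simp only [Matrix.toLpLin_apply, Matrix.mulVec, dotProduct, hB, Finset.sum_mul]
  rw [Finset.sum_comm]
  exact Finset.sum_congr rfl fun _ _ => Finset.sum_congr rfl fun _ _ => mul_right_comm _ _ _

theorem isPoisson_of_structureConstants (hB : ∀ p j k, B p j k = ∑ m, c m j k * p m)
    (antisymm : ∀ m j k, c m j k = -c m k j)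
    (jacobi : ∀ m i j k,
      ∑ l, (c m i l * c l j k + c m j l * c l k i + c m k l * c l i j) = 0) :
    IsPoisson B where
  smooth j k := by
    simp only [hB]
    fun_prop
  antisymm p j k := by
    simp only [hB, antisymm _ j k, neg_mul, Finset.sum_neg_distrib]
  jacobi p i j k := by
    simp only [bracket_coord_of_structureConstants hB, ← Finset.sum_add_distrib, ← add_mul,
      jacobi, zero_mul, Finset.sum_const_zero]

end LiePoisson

section TransverseSpectrum

variable {B : MatField n} {J H : Vec n → ℝ} {p : Vec n} {ι : Type*}

theorem exists_conj_eigenvector_iff (μ z : ℂ) :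
    (∃ a c : ℂ, ¬ (a = 0 ∧ c = 0) ∧ μ * a = z.re * a - z.im * c ∧ μ * c = z.im * a + z.re * c) ↔
      z = μ ∨ z = conj μ := by
  have hz : z = z.re + z.im * Complex.I := (Complex.re_add_im z).symm
  have hz' : conj z = z.re - z.im * Complex.I := by
    simpa [mul_comm, sub_eq_add_neg] using congrArg conj hz
  constructor
  · rintro ⟨a, c, hac, h₁, h₂⟩
    have hplus : (z - μ) * (a + Complex.I * c) = 0 := by
      linear_combination (a + Complex.I * c) * hz - h₁ - Complex.I * h₂
        + z.im * c * Complex.I_sq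
    have hminus : (conj z - μ) * (a - Complex.I * c) = 0 := by
      linear_combination (a - Complex.I * c) * hz' - h₁ + Complex.I * h₂
        + z.im * c * Complex.I_sq
    rcases mul_eq_zero.1 hplus with h | h
    · exact Or.inl (sub_eq_zero.1 h)
    rcases mul_eq_zero.1 hminus with h' | h'
    · exact Or.inr (by rw [← sub_eq_zero.1 h', Complex.conj_conj])
    · refine absurd ⟨?_, ?_⟩ hac
      · linear_combination (h + h') / 2
      · linear_combination (h - h') * (-Complex.I / 2) + c * Complex.I_sq
  · rintro (rfl | h)
    · refine ⟨1, -Complex.I, by simp, ?_, ?_⟩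
      · linear_combination hz
      · linear_combination -Complex.I * hz - z.im * Complex.I_sq
    · have hμ : μ = conj z := by rw [h, Complex.conj_conj]
      refine ⟨1, Complex.I, by simp, ?_, ?_⟩
      · linear_combination hμ + hz'
      · linear_combination Complex.I * (hμ + hz') - z.im * Complex.I_sq

theorem injective_sumElim_conj {f : ι → ℂ} (hf : Function.Injective f)
    (him : ∀ i, 0 < (f i).im) : Function.Injective (Sum.elim f (conj ∘ f)) := by
  refine hf.sumElim (star_injective.comp hf) fun i j h => ?_
  have := congrArg Complex.im h
  simp only [Function.comp_apply, Complex.conj_im] at this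
  linarith [him i, him j]

variable (B J H p) in
/-- Complex coordinates `F` which identify the real space `K / L` with `ι → ℂ` and in which every
combination `s J + t H` that is critical at `p` induces the diagonal operator with entries `μ s t`.
In this way all points of elliptic, elliptic-regular and focus-focus type are treated alike. -/
structure IsTransverseDiagonalisation (F : Vec n →ₗ[ℝ] ι → ℂ) (μ : ℝ → ℝ → ι → ℂ) : Prop where
  mem_orbitSpace_iff : ∀ v ∈ commonKernel B J H p, v ∈ orbitSpace B J H p ↔ F v = 0
  exists_eq : ∀ c, ∃ v ∈ commonKernel B J H p, F v = c
  linearisation_mem : ∀ s t, hamVF B (comb J H s t) p = 0 → ∀ v ∈ commonKernel B J H p,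
    linearisation B J H p s t v ∈ commonKernel B J H p
  map_linearisation : ∀ s t, hamVF B (comb J H s t) p = 0 → ∀ v ∈ commonKernel B J H p,
    F (linearisation B J H p s t v) = μ s t * F v

namespace IsTransverseDiagonalisation

variable {F : Vec n →ₗ[ℝ] ι → ℂ} {μ : ℝ → ℝ → ι → ℂ}
  (h : IsTransverseDiagonalisation B J H p F μ) {s t : ℝ}
include h

theorem linearisation_sub_mem_iff (hcrit : hamVF B (comb J H s t) p = 0) {v v' : Vec n}
    (hv : v ∈ commonKernel B J H p) (hv' : v' ∈ commonKernel B J H p) :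
    linearisation B J H p s t v - v' ∈ orbitSpace B J H p ↔ ∀ j, μ s t j * F v j = F v' j := by
  rw [h.mem_orbitSpace_iff _ (sub_mem (h.linearisation_mem s t hcrit v hv) hv'), map_sub,
    h.map_linearisation s t hcrit v hv, sub_eq_zero, funext_iff]
  rfl

theorem linearisation_mem_iff (hcrit : hamVF B (comb J H s t) p = 0) {v : Vec n}
    (hv : v ∈ commonKernel B J H p) :
    linearisation B J H p s t v ∈ orbitSpace B J H p ↔ ∀ j, μ s t j * F v j = 0 := by
  simpa using h.linearisation_sub_mem_iff hcrit hv (zero_mem _)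

theorem forall_linearisation_mem_iff (hcrit : hamVF B (comb J H s t) p = 0) :
    (∀ v ∈ commonKernel B J H p, linearisation B J H p s t v ∈ orbitSpace B J H p) ↔
      μ s t = 0 := by
  constructor
  · intro hL
    obtain ⟨v, hv, hFv⟩ := h.exists_eq 1
    funext j
    simpa [hFv] using (h.linearisation_mem_iff hcrit hv).1 (hL v hv) j
  · intro hμ v hv
    simp [h.linearisation_mem_iff hcrit hv, hμ]

theorem isTransverseEigenvalue_iff (hcrit : hamVF B (comb J H s t) p = 0) (z : ℂ) :
    IsTransverseEigenvalue B J H p s t z ↔ ∃ j, z = μ s t j ∨ z = conj (μ s t j) := by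
  classical
  set K := commonKernel B J H p
  have eigenpair_iff {u v : Vec n} (hu : u ∈ K) (hv : v ∈ K) :
      linearisation B J H p s t u - (z.re • u - z.im • v) ∈ orbitSpace B J H p ∧
        linearisation B J H p s t v - (z.im • u + z.re • v) ∈ orbitSpace B J H p ↔
      ∀ j, μ s t j * F u j = z.re * F u j - z.im * F v j ∧
        μ s t j * F v j = z.im * F u j + z.re * F v j := by
    rw [h.linearisation_sub_mem_iff hcrit hu (sub_mem (K.smul_mem _ hu) (K.smul_mem _ hv)),
      h.linearisation_sub_mem_iff hcrit hv (add_mem (K.smul_mem _ hu) (K.smul_mem _ hv)),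
      ← forall_and]
    simp
  simp only [← exists_conj_eigenvector_iff]
  constructor
  · rintro ⟨u, hu, v, hv, huv, hpair⟩
    rw [h.mem_orbitSpace_iff u hu, h.mem_orbitSpace_iff v hv, funext_iff, funext_iff,
      ← forall_and, not_forall] at huv
    obtain ⟨j, hj⟩ := huv
    exact ⟨j, F u j, F v j, hj, (eigenpair_iff hu hv).1 hpair j⟩
  · rintro ⟨j, a, c, hac, h₁, h₂⟩
    obtain ⟨u, hu, hFu⟩ := h.exists_eq (Pi.single j a)
    obtain ⟨v, hv, hFv⟩ := h.exists_eq (Pi.single j c)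
    refine ⟨u, hu, v, hv, ?_, (eigenpair_iff hu hv).2 fun k => ?_⟩
    · simpa [h.mem_orbitSpace_iff, hu, hv, hFu, hFv] using hac
    · obtain rfl | hk := eq_or_ne k j
      · simpa [hFu, hFv] using ⟨h₁, h₂⟩
      · simp [hFu, hFv, hk]

variable [Fintype ι]

theorem isRegularComb (hcrit : hamVF B (comb J H s t) p = 0)
    (hdim : Fintype.card ι + rank B J H p = 2)
    (hμ : Function.Injective (Sum.elim (μ s t) (conj ∘ μ s t))) : IsRegularComb B J H p s t := by
  have hspectrum : {z | IsTransverseEigenvalue B J H p s t z} =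
      Set.range (Sum.elim (μ s t) (conj ∘ μ s t)) := by
    ext z
    simp [h.isTransverseEigenvalue_iff hcrit, exists_or, eq_comm]
  refine ⟨hcrit, ?_⟩
  rw [hspectrum, ← Set.image_univ, hμ.encard_image, Set.encard_univ,
    ENat.card_eq_coe_fintype_card, Fintype.card_sum]
  norm_cast
  lia

theorem isNondegenerate (hdim : Fintype.card ι + rank B J H p = 2)
    (hker : ∀ s t, hamVF B (comb J H s t) p = 0 → μ s t = 0 → s = 0 ∧ t = 0)
    (hcrit : hamVF B (comb J H s t) p = 0)
    (hμ : Function.Injective (Sum.elim (μ s t) (conj ∘ μ s t))) : IsNondegenerate B J H p :=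
  ⟨fun s' t' hcrit' hL => hker s' t' hcrit' ((h.forall_linearisation_mem_iff hcrit').1 hL),
    s, t, h.isRegularComb hcrit hdim hμ⟩

theorem isEllipticPoint [Nonempty ι] (hdim : Fintype.card ι + rank B J H p = 2)
    (hker : ∀ s t, hamVF B (comb J H s t) p = 0 → μ s t = 0 → s = 0 ∧ t = 0)
    (hcrit : hamVF B (comb J H s t) p = 0)
    (hμ : Function.Injective (Sum.elim (μ s t) (conj ∘ μ s t)))
    (hre : ∀ j, (μ s t j).re = 0) : IsEllipticPoint B J H p := by
  refine ⟨?_, h.isNondegenerate hdim hker hcrit hμ, s, t, h.isRegularComb hcrit hdim hμ,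
    fun z hz => ?_⟩
  · have := Fintype.card_pos (α := ι)
    rw [IsSingular]
    lia
  · obtain ⟨j, rfl | rfl⟩ := (h.isTransverseEigenvalue_iff hcrit z).1 hz
    · exact hre j
    · rw [Complex.conj_re, hre j]

end IsTransverseDiagonalisation

end TransverseSpectrum

section Rank

variable {B : MatField n} {J H : Vec n → ℝ} {p : Vec n}

theorem IsSingular.exists_eq_smul (h : IsSingular B J H p) (hJ : hamVF B J p ≠ 0) :
    ∃ c : ℝ, hamVF B H p = c • hamVF B J p := by
  by_contra! hc
  have hli : LinearIndependent ℝ ![hamVF B J p, hamVF B H p] :=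
    (LinearIndependent.pair_iff' hJ).2 fun a => (hc a).symm
  have hrank := finrank_span_eq_card hli
  rw [Matrix.range_cons_cons_empty, Fintype.card_fin] at hrank
  exact h.ne hrank

theorem orbitSpace_eq_span {c : ℝ} (h : hamVF B H p = c • hamVF B J p) :
    orbitSpace B J H p = Submodule.span ℝ {hamVF B J p} := by
  rw [orbitSpace, h, Set.pair_comm]
  exact Submodule.span_insert_eq_span
    (Submodule.smul_mem _ _ (Submodule.mem_span_singleton_self _))

theorem rank_eq_one {c : ℝ} (hJ : hamVF B J p ≠ 0) (h : hamVF B H p = c • hamVF B J p) :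
    rank B J H p = 1 := by
  rw [rank, orbitSpace_eq_span h, finrank_span_singleton hJ]

theorem orbitSpace_eq_bot_iff :
    orbitSpace B J H p = ⊥ ↔ hamVF B J p = 0 ∧ hamVF B H p = 0 := by
  simp [orbitSpace, Submodule.span_eq_bot]

theorem rank_eq_zero_iff : rank B J H p = 0 ↔ hamVF B J p = 0 ∧ hamVF B H p = 0 := by
  rw [rank, Submodule.finrank_eq_zero, orbitSpace_eq_bot_iff]

/-- The reduced equations `f' = t m g`, `g' = -t k f` are those of a harmonic oscillator of
frequency `t √(m k)`, with complex coordinate `k f - i √(m k) g`. -/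
theorem isEllipticPoint_of_oscillator {f g : Vec n →ₗ[ℝ] ℝ} {m k : ℝ} (hm : 0 < m) (hk : 0 < k)
    (hrank : rank B J H p = 1)
    (mem_orbitSpace_iff :
      ∀ v ∈ commonKernel B J H p, v ∈ orbitSpace B J H p ↔ f v = 0 ∧ g v = 0)
    (exists_eq : ∀ x y, ∃ v ∈ commonKernel B J H p, f v = x ∧ g v = y)
    (linearisation_mem : ∀ s t, hamVF B (comb J H s t) p = 0 → ∀ v ∈ commonKernel B J H p,
      linearisation B J H p s t v ∈ commonKernel B J H p)
    (map_linearisation : ∀ s t, hamVF B (comb J H s t) p = 0 → ∀ v ∈ commonKernel B J H p,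
      f (linearisation B J H p s t v) = t * m * g v ∧
        g (linearisation B J H p s t v) = -(t * k * f v))
    (hker : ∀ s, hamVF B (comb J H s 0) p = 0 → s = 0) {s : ℝ}
    (hcrit : hamVF B (comb J H s 1) p = 0) : IsEllipticPoint B J H p := by
  obtain ⟨ν, hν, hν_sq⟩ : ∃ ν : ℝ, 0 < ν ∧ ν ^ 2 = m * k :=
    ⟨√(m * k), by positivity, Real.sq_sqrt (by positivity)⟩
  let F : Vec n →ₗ[ℝ] Unit → ℂ := LinearMap.pi fun _ =>
    Complex.equivRealProdLm.symm.toLinearMap ∘ₗ (k • f).prod (-(ν • g))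
  have F_apply (v j) : F v j = ⟨k * f v, -(ν * g v)⟩ := rfl
  have hF : IsTransverseDiagonalisation B J H p F fun _ t _ => ⟨0, t * ν⟩ :=
    { mem_orbitSpace_iff v hv := by
        simp [mem_orbitSpace_iff v hv, funext_iff, F_apply, Complex.ext_iff, hk.ne', hν.ne']
      exists_eq c := by
        obtain ⟨v, hv, hf, hg⟩ := exists_eq ((c ()).re / k) (-(c ()).im / ν)
        refine ⟨v, hv, funext fun _ => ?_⟩
        rw [F_apply, hf, hg, mul_div_cancel₀ _ hk.ne', mul_div_cancel₀ _ hν.ne', neg_neg]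
      linearisation_mem
      map_linearisation s t hst v hv := by
        obtain ⟨hf, hg⟩ := map_linearisation s t hst v hv
        refine funext fun j => Complex.ext ?_ ?_
        · simp only [Pi.mul_apply, F_apply, hf, Complex.mul_re]
          linear_combination -(t * g v) * hν_sq
        · simp only [Pi.mul_apply, F_apply, hg, Complex.mul_im]
          ring }
  refine hF.isEllipticPoint (s := s) (t := 1) (by simp [hrank]) (fun s t hst hμ => ?_) hcrit ?_
    fun _ => rfl
  · obtain rfl : t = 0 := by simpa [funext_iff, Complex.ext_iff, hν.ne'] using hμ
    exact ⟨hker s hst, rfl⟩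
  · exact injective_sumElim_conj (Function.injective_of_subsingleton _) (by simpa using hν)

end Rank

end PoissonSystem

namespace Prolate

open PoissonSystem

section Coordinates

/-- The complex coordinate `u = ℓ₁₂ + i ℓ₁₃`. -/
noncomputable def coordU : Vec 6 →L[ℝ] ℂ :=
  LinearMap.toContinuousLinearMap
    { toFun p := ⟨p 0, p 1⟩
      map_add' _ _ := rfl
      map_smul' _ _ := by simp [Complex.ext_iff] }

/-- The complex coordinate `w = ℓ₂₄ + i ℓ₃₄`. -/
noncomputable def coordW : Vec 6 →L[ℝ] ℂ :=
  LinearMap.toContinuousLinearMap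
    { toFun p := ⟨p 4, p 5⟩
      map_add' _ _ := rfl
      map_smul' _ _ := by simp [Complex.ext_iff] }

/-- The vector with coordinates `(u, x, y, w)`, where `x = ℓ₁₄` and `y = ℓ₂₃`. In these coordinates
`ℓ₂₃` generates the simultaneous rotation of `u` and `w`. -/
noncomputable def ofCoords : (ℂ × ℝ × ℝ × ℂ) →L[ℝ] Vec 6 :=
  LinearMap.toContinuousLinearMap
    { toFun q := !₂[q.1.re, q.1.im, q.2.1, q.2.2.1, q.2.2.2.re, q.2.2.2.im]
      map_add' _ _ := by ext i; fin_cases i <;> rfl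
      map_smul' _ _ := by ext i; fin_cases i <;> simp }

@[simp] theorem coordU_re (p : Vec 6) : (coordU p).re = p 0 := rfl
@[simp] theorem coordU_im (p : Vec 6) : (coordU p).im = p 1 := rfl
@[simp] theorem coordW_re (p : Vec 6) : (coordW p).re = p 4 := rfl
@[simp] theorem coordW_im (p : Vec 6) : (coordW p).im = p 5 := rfl

variable (u w : ℂ) (x y : ℝ)

@[simp] theorem coordU_ofCoords : coordU (ofCoords (u, x, y, w)) = u := rfl
@[simp] theorem coordW_ofCoords : coordW (ofCoords (u, x, y, w)) = w := rfl
@[simp] theorem ofCoords_apply_zero : ofCoords (u, x, y, w) 0 = u.re := rfl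
@[simp] theorem ofCoords_apply_one : ofCoords (u, x, y, w) 1 = u.im := rfl
@[simp] theorem ofCoords_apply_two : ofCoords (u, x, y, w) 2 = x := rfl
@[simp] theorem ofCoords_apply_three : ofCoords (u, x, y, w) 3 = y := rfl
@[simp] theorem ofCoords_apply_four : ofCoords (u, x, y, w) 4 = w.re := rfl
@[simp] theorem ofCoords_apply_five : ofCoords (u, x, y, w) 5 = w.im := rfl

theorem ofCoords_coords (p : Vec 6) : ofCoords (coordU p, p 2, p 3, coordW p) = p := by
  ext i
  fin_cases i <;> rfl

theorem ext_coords {p q : Vec 6} (hu : coordU p = coordU q) (hx : p 2 = q 2) (hy : p 3 = q 3)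
    (hw : coordW p = coordW q) : p = q := by
  rw [← ofCoords_coords p, hu, hx, hy, hw, ofCoords_coords]

variable {u w x y} in
theorem ofCoords_eq_zero_iff :
    ofCoords (u, x, y, w) = 0 ↔ u = 0 ∧ x = 0 ∧ y = 0 ∧ w = 0 := by
  constructor
  · intro h
    exact ⟨congrArg coordU h, congrArg (· 2) h, congrArg (· 3) h, congrArg coordW h⟩
  · rintro ⟨rfl, rfl, rfl, rfl⟩
    exact map_zero ofCoords

end Coordinates

section VectorFields

theorem gPro_eq (b : ℝ) (p : Vec 6) : gPro b p = b * ‖coordU p‖ ^ 2 + p 2 ^ 2 := by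
  rw [← Complex.normSq_eq_norm_sq, Complex.normSq_apply, coordU_re, coordU_im, gPro]
  ring

theorem contDiff_ell23 {m : WithTop ℕ∞} : ContDiff ℝ m ell23 := by
  unfold ell23
  fun_prop

theorem contDiff_gPro (b : ℝ) {m : WithTop ℕ∞} : ContDiff ℝ m (gPro b) := by
  unfold gPro
  fun_prop

theorem fderiv_comb_apply (b s t : ℝ) (p v : Vec 6) :
    fderiv ℝ (comb ell23 (gPro b) s t) p v =
      s * v 3 + 2 * t * (b * (conj (coordU p) * coordU v).re + p 2 * v 2) := by
  have hdiff : ContDiff ℝ 1 (comb ell23 (gPro b) s t) :=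
    (contDiff_const.mul contDiff_ell23).add (contDiff_const.mul (contDiff_gPro b))
  refine fderiv_apply_eq_of_forall_add_smul (q := t * gPro b v)
    (hdiff.differentiable one_ne_zero p) fun τ => ?_
  simp only [comb, ell23, gPro, PiLp.add_apply, PiLp.smul_apply, smul_eq_mul, Complex.mul_re,
    Complex.conj_re, Complex.conj_im, coordU_re, coordU_im]
  ring

theorem gradient_comb (b s t : ℝ) (p : Vec 6) :
    gradient (comb ell23 (gPro b) s t) p =
      ofCoords (2 * t * b * coordU p, 2 * t * p 2, s, 0) := by
  refine gradient_eq_iff_forall_fderiv.2 fun v => ?_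
  rw [fderiv_comb_apply]
  simp [PiLp.inner_apply, Fin.sum_univ_six]
  ring

theorem fderiv_ell23_apply (p v : Vec 6) : fderiv ℝ ell23 p v = v 3 := by
  rw [← comb_one_zero ell23 (gPro 0), fderiv_comb_apply]
  ring

theorem fderiv_gPro_apply (b : ℝ) (p v : Vec 6) :
    fderiv ℝ (gPro b) p v = 2 * (b * (conj (coordU p) * coordU v).re + p 2 * v 2) := by
  rw [← comb_zero_one ell23 (gPro b), fderiv_comb_apply]
  ring

theorem toEuclideanLin_structureMatrix (p v : Vec 6) :
    Matrix.toEuclideanLin (structureMatrix p) v =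
      !₂[p 3 * v 1 + p 4 * v 2 - p 1 * v 3 - p 2 * v 4,
        -p 3 * v 0 + p 5 * v 2 + p 0 * v 3 - p 2 * v 5,
        -p 4 * v 0 - p 5 * v 1 + p 0 * v 4 + p 1 * v 5,
        p 1 * v 0 - p 0 * v 1 + p 5 * v 4 - p 4 * v 5,
        p 2 * v 0 - p 0 * v 2 - p 5 * v 3 + p 3 * v 5,
        p 2 * v 1 - p 1 * v 2 + p 4 * v 3 - p 3 * v 4] := by
  ext i
  fin_cases i <;>
    simp [structureMatrix, Matrix.toLpLin_apply, dotProduct, Fin.sum_univ_six] <;>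
    ring

theorem hamVF_comb (b s t : ℝ) (p : Vec 6) :
    hamVF structureMatrix (comb ell23 (gPro b) s t) p =
      ofCoords (Complex.I * (s - 2 * t * b * p 3) * coordU p + 2 * t * p 2 * coordW p,
        -(2 * t * b * (coordU p * conj (coordW p)).re), 0,
        Complex.I * s * coordW p + 2 * t * (b - 1) * p 2 * coordU p) := by
  rw [hamVF, gradient_comb, toEuclideanLin_structureMatrix]
  ext i
  fin_cases i <;> simp <;> ring

theorem hamVF_ell23 (p : Vec 6) :
    hamVF structureMatrix ell23 p =
      ofCoords (Complex.I * coordU p, 0, 0, Complex.I * coordW p) := by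
  rw [← comb_one_zero ell23 (gPro 0), hamVF_comb]
  simp

theorem hamVF_gPro (b : ℝ) (p : Vec 6) :
    hamVF structureMatrix (gPro b) p =
      ofCoords (2 * (p 2 * coordW p - Complex.I * b * p 3 * coordU p),
        -(2 * b * (coordU p * conj (coordW p)).re), 0, 2 * (b - 1) * p 2 * coordU p) := by
  rw [← comb_zero_one ell23 (gPro b), hamVF_comb]
  congr 2
  · push_cast
    ring
  · simp

theorem bracket_ell23_gPro (b : ℝ) (p : Vec 6) :
    bracket structureMatrix ell23 (gPro b) p = 0 := by
  rw [bracket_eq_fderiv, fderiv_ell23_apply, hamVF_gPro, ofCoords_apply_three]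

theorem differentiable_hamVF_comb (b s t : ℝ) :
    Differentiable ℝ (hamVF structureMatrix (comb ell23 (gPro b) s t)) := by
  simp only [funext (hamVF_comb b s t)]
  fun_prop

theorem linearisation_apply (b s t : ℝ) (p v : Vec 6) :
    linearisation structureMatrix ell23 (gPro b) p s t v =
      ofCoords (Complex.I * ((s - 2 * t * b * p 3) * coordU v - 2 * t * b * v 3 * coordU p)
          + 2 * t * (p 2 * coordW v + v 2 * coordW p),
        -(2 * t * b * (coordU v * conj (coordW p) + coordU p * conj (coordW v)).re), 0,
        Complex.I * s * coordW v + 2 * t * (b - 1) * (p 2 * coordU v + v 2 * coordU p)) := by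
  refine fderiv_apply_eq_of_forall_add_smul
    (q := hamVF structureMatrix (comb ell23 (gPro b) 0 t) v)
    (differentiable_hamVF_comb b s t p) fun τ => ?_
  simp only [hamVF_comb]
  ext i
  fin_cases i <;> simp <;> ring

end VectorFields

section SymplecticLeaf

/-- The Hodge star on `Λ²ℝ⁴`, under which the second Casimir is `½ ⟪⋆L, L⟫`. -/
noncomputable def hodgeStar : Vec 6 →L[ℝ] Vec 6 :=
  LinearMap.toContinuousLinearMap
    { toFun v := !₂[v 5, -v 4, v 3, v 2, -v 1, v 0]
      map_add' _ _ := by ext i; fin_cases i <;> simp <;> ring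
      map_smul' _ _ := by ext i; fin_cases i <;> simp }

theorem hodgeStar_apply (v : Vec 6) : hodgeStar v = !₂[v 5, -v 4, v 3, v 2, -v 1, v 0] := rfl

theorem inner_eq_coords (p v : Vec 6) :
    inner ℝ p v = (conj (coordU p) * coordU v).re + p 2 * v 2 + p 3 * v 3
      + (conj (coordW p) * coordW v).re := by
  simp [PiLp.inner_apply, Fin.sum_univ_six]
  ring

theorem inner_hodgeStar_eq_coords (p v : Vec 6) :
    inner ℝ (hodgeStar p) v = (conj (coordU p) * coordW v).im + p 2 * v 3 + p 3 * v 2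
      + (conj (coordU v) * coordW p).im := by
  simp [hodgeStar_apply, PiLp.inner_apply, Fin.sum_univ_six]
  ring

theorem inner_hodgeStar_comm (p v : Vec 6) :
    inner ℝ (hodgeStar p) v = inner ℝ (hodgeStar v) p := by
  simp only [inner_hodgeStar_eq_coords]
  ring

theorem inner_hodgeStar_hodgeStar (p v : Vec 6) :
    inner ℝ (hodgeStar p) (hodgeStar v) = inner ℝ p v := by
  simp [hodgeStar_apply, PiLp.inner_apply, Fin.sum_univ_six]
  ring

theorem mem_phaseSpace_iff_inner {p : Vec 6} :
    p ∈ phaseSpace ↔ inner ℝ p p = 1 ∧ inner ℝ (hodgeStar p) p = 0 := by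
  have hself : inner ℝ p p = p 0 ^ 2 + p 1 ^ 2 + p 2 ^ 2 + p 3 ^ 2 + p 4 ^ 2 + p 5 ^ 2 := by
    rw [real_inner_self_eq_norm_sq, EuclideanSpace.real_norm_sq_eq, Fin.sum_univ_six]
  have hstar : inner ℝ (hodgeStar p) p = 2 * (p 0 * p 5 - p 1 * p 4 + p 2 * p 3) := by
    simp [hodgeStar_apply, PiLp.inner_apply, Fin.sum_univ_six]
    ring
  rw [mem_phaseSpace_iff, hself, hstar, mul_eq_zero_iff_left two_ne_zero]

theorem mem_phaseSpace_iff_coords {p : Vec 6} :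
    p ∈ phaseSpace ↔
      ‖coordU p‖ ^ 2 + p 2 ^ 2 + p 3 ^ 2 + ‖coordW p‖ ^ 2 = 1 ∧
        (conj (coordU p) * coordW p).im + p 2 * p 3 = 0 := by
  rw [mem_phaseSpace_iff, ← Complex.normSq_eq_norm_sq, ← Complex.normSq_eq_norm_sq]
  simp only [Complex.normSq_apply, Complex.mul_im, Complex.conj_re, Complex.conj_im, coordU_re,
    coordU_im, coordW_re, coordW_im]
  ring_nf

theorem inner_toEuclideanLin_structureMatrix (p v : Vec 6) :
    inner ℝ p (Matrix.toEuclideanLin (structureMatrix p) v) = 0 := by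
  simp [toEuclideanLin_structureMatrix, PiLp.inner_apply, Fin.sum_univ_six]
  ring

theorem inner_hodgeStar_toEuclideanLin_structureMatrix (p v : Vec 6) :
    inner ℝ (hodgeStar p) (Matrix.toEuclideanLin (structureMatrix p) v) = 0 := by
  simp [toEuclideanLin_structureMatrix, hodgeStar_apply, PiLp.inner_apply, Fin.sum_univ_six]
  ring

theorem toEuclideanLin_structureMatrix_sq (p v : Vec 6) :
    Matrix.toEuclideanLin (structureMatrix p) (Matrix.toEuclideanLin (structureMatrix p) v) =
      inner ℝ p v • p + inner ℝ (hodgeStar p) v • hodgeStar p - inner ℝ p p • v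
        - inner ℝ (hodgeStar p) p • hodgeStar v := by
  simp only [toEuclideanLin_structureMatrix, hodgeStar_apply, PiLp.inner_apply,
    Fin.sum_univ_six]
  ext i
  fin_cases i <;> simp <;> ring

theorem mem_charSpace_iff {p : Vec 6} (hp : p ∈ phaseSpace) {v : Vec 6} :
    v ∈ charSpace structureMatrix p ↔ inner ℝ p v = 0 ∧ inner ℝ (hodgeStar p) v = 0 := by
  constructor
  · rintro ⟨η, rfl⟩
    exact ⟨inner_toEuclideanLin_structureMatrix p η,
      inner_hodgeStar_toEuclideanLin_structureMatrix p η⟩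
  · rintro ⟨h₁, h₂⟩
    obtain ⟨hp₁, hp₂⟩ := mem_phaseSpace_iff_inner.1 hp
    refine ⟨-Matrix.toEuclideanLin (structureMatrix p) v, ?_⟩
    rw [map_neg, toEuclideanLin_structureMatrix_sq, h₁, h₂, hp₁, hp₂]
    module

/-- The two Casimirs, normalised so that the phase space is their common zero set. -/
noncomputable def casimirs (p : Vec 6) : Vec 2 :=
  !₂[inner ℝ p p - 1, inner ℝ (hodgeStar p) p]

theorem casimirs_eq_zero_iff {p : Vec 6} : casimirs p = 0 ↔ p ∈ phaseSpace := by
  rw [mem_phaseSpace_iff_inner, casimirs, PiLp.ext_iff, Fin.forall_fin_two]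
  simp [sub_eq_zero]

theorem contDiff_casimirs {m : WithTop ℕ∞} : ContDiff ℝ m casimirs := by
  rw [contDiff_euclidean, Fin.forall_fin_two]
  constructor
  · exact (contDiff_id.inner ℝ contDiff_id).sub contDiff_const
  · exact hodgeStar.contDiff.inner ℝ contDiff_id

theorem fderiv_casimirs_apply (p v : Vec 6) :
    fderiv ℝ casimirs p v = !₂[2 * inner ℝ p v, 2 * inner ℝ (hodgeStar p) v] := by
  refine fderiv_apply_eq_of_forall_add_smul (q := !₂[inner ℝ v v, inner ℝ (hodgeStar v) v])
    ((contDiff_casimirs (m := 1)).differentiable one_ne_zero p) fun τ => ?_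
  have hself : inner ℝ (p + τ • v) (p + τ • v) =
      inner ℝ p p + τ * (2 * inner ℝ p v) + τ ^ 2 * inner ℝ v v := by
    simp only [inner_add_left, inner_add_right, real_inner_smul_left, real_inner_smul_right,
      real_inner_comm p v]
    ring
  have hstar : inner ℝ (hodgeStar (p + τ • v)) (p + τ • v) = inner ℝ (hodgeStar p) p
      + τ * (2 * inner ℝ (hodgeStar p) v) + τ ^ 2 * inner ℝ (hodgeStar v) v := by
    simp only [map_add, map_smul, inner_add_left, inner_add_right, real_inner_smul_left,
      real_inner_smul_right, inner_hodgeStar_comm v p]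
    ring
  rw [casimirs, hself, hstar]
  ext i
  fin_cases i
  · simp [casimirs]
    ring
  · simp [casimirs]

theorem fderiv_casimirs_eq_zero_iff {p v : Vec 6} :
    fderiv ℝ casimirs p v = 0 ↔ inner ℝ p v = 0 ∧ inner ℝ (hodgeStar p) v = 0 := by
  rw [fderiv_casimirs_apply, PiLp.ext_iff, Fin.forall_fin_two]
  simp

theorem surjective_fderiv_casimirs {p : Vec 6} (hp : p ∈ phaseSpace) :
    Function.Surjective (fderiv ℝ casimirs p) := by
  obtain ⟨hp₁, hp₂⟩ := mem_phaseSpace_iff_inner.1 hp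
  have hp₂' : inner ℝ p (hodgeStar p) = 0 := by rw [real_inner_comm, hp₂]
  intro y
  refine ⟨(y 0 / 2) • p + (y 1 / 2) • hodgeStar p, ?_⟩
  rw [fderiv_casimirs_apply]
  simp only [inner_add_right, real_inner_smul_right, inner_hodgeStar_hodgeStar, hp₁, hp₂, hp₂']
  ext i
  fin_cases i <;> simp <;> ring

/-- The inverse of the linear isomorphism `L ↦ (X, Y)`. -/
noncomputable def ofXY : (Vec 3 × Vec 3) →L[ℝ] Vec 6 :=
  LinearMap.toContinuousLinearMap
    { toFun q := !₂[q.1 0 + q.2 0, q.1 1 - q.2 1, q.1 2 + q.2 2, q.1 2 - q.2 2,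
        -(q.1 1 + q.2 1), q.1 0 - q.2 0]
      map_add' _ _ := by ext i; fin_cases i <;> simp <;> ring
      map_smul' _ _ := by ext i; fin_cases i <;> simp <;> ring }

theorem ofXY_apply (X Y : Vec 3) :
    ofXY (X, Y) = !₂[X 0 + Y 0, X 1 - Y 1, X 2 + Y 2, X 2 - Y 2, -(X 1 + Y 1), X 0 - Y 0] := rfl

theorem phaseSpace_eq_image :
    phaseSpace = ofXY '' (Metric.sphere 0 (1 / 2) ×ˢ Metric.sphere 0 (1 / 2)) := by
  have leftInv (p : Vec 6) : ofXY (vecX p, vecY p) = p := by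
    ext i
    fin_cases i <;> simp [ofXY_apply, vecX, vecY] <;> ring
  have vecX_ofXY (X Y : Vec 3) : vecX (ofXY (X, Y)) = X := by
    ext i
    fin_cases i <;> simp [ofXY_apply, vecX]; ring
  have vecY_ofXY (X Y : Vec 3) : vecY (ofXY (X, Y)) = Y := by
    ext i
    fin_cases i <;> simp [ofXY_apply, vecY]; ring
  ext p
  constructor
  · intro hp
    exact ⟨(vecX p, vecY p), hp, leftInv p⟩
  · rintro ⟨⟨X, Y⟩, ⟨hX, hY⟩, rfl⟩
    exact ⟨by rwa [vecX_ofXY], by rwa [vecY_ofXY]⟩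

theorem isConnected_phaseSpace : IsConnected phaseSpace := by
  have hsphere : IsConnected (Metric.sphere (0 : Vec 3) (1 / 2)) := by
    refine isConnected_sphere ?_ 0 (by norm_num)
    rw [← finrank_eq_rank, finrank_euclideanSpace_fin]
    norm_num
  rw [phaseSpace_eq_image]
  exact (hsphere.prod hsphere).image _ ofXY.continuous.continuousOn

theorem isCompact_phaseSpace : IsCompact phaseSpace := by
  rw [phaseSpace_eq_image]
  exact ((isCompact_sphere _ _).prod (isCompact_sphere _ _)).image ofXY.continuous

/-- The structure constants of `so(4)`, the integers `cₘⱼₖ` with `Bⱼₖ(L) = ∑ₘ cₘⱼₖ Lₘ`. They are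
integers, not reals, so that the Jacobi identity is decidable. -/
def structureConstant (m j k : Fin 6) : ℤ :=
  let L : Fin 6 → ℤ := Pi.single m 1
  !![    0,  L 3,  L 4, -L 1, -L 2,    0;
      -L 3,    0,  L 5,  L 0,    0, -L 2;
      -L 4, -L 5,    0,    0,  L 0,  L 1;
       L 1, -L 0,    0,    0,  L 5, -L 4;
       L 2,    0, -L 0, -L 5,    0,  L 3;
         0,  L 2, -L 1,  L 4, -L 3,    0] j k

theorem structureMatrix_apply (p : Vec 6) (j k : Fin 6) :
    structureMatrix p j k = ∑ m, (structureConstant m j k : ℝ) * p m := by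
  fin_cases j <;> fin_cases k <;>
    simp [structureMatrix, structureConstant, Fin.sum_univ_six]

theorem structureConstant_antisymm : ∀ m j k,
    structureConstant m j k = -structureConstant m k j := by
  decide +kernel

theorem structureConstant_jacobi : ∀ m i j k,
    ∑ l, (structureConstant m i l * structureConstant l j k
      + structureConstant m j l * structureConstant l k i
      + structureConstant m k l * structureConstant l i j) = 0 := by
  decide +kernel

theorem isPoisson_structureMatrix : IsPoisson structureMatrix :=
  isPoisson_of_structureConstants structureMatrix_apply
    (fun m j k => by exact_mod_cast structureConstant_antisymm m j k)
    (fun m i j k => by exact_mod_cast structureConstant_jacobi m i j k)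

theorem isSymplecticManifold_phaseSpace : IsSymplecticManifold structureMatrix phaseSpace 4 where
  poisson := isPoisson_structureMatrix
  connected := isConnected_phaseSpace
  submanifold p hp := by
    refine ⟨2, rfl, Set.univ, isOpen_univ, trivial, casimirs, contDiff_casimirs.contDiffOn, ?_,
      surjective_fderiv_casimirs hp, ?_⟩
    · ext q
      simp [casimirs_eq_zero_iff]
    · ext v
      exact fderiv_casimirs_eq_zero_iff.trans (mem_charSpace_iff hp).symm

end SymplecticLeaf

section SingularPoints

variable {b : ℝ} {p v : Vec 6}

theorem mem_commonKernel_iff (hp : p ∈ phaseSpace) :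
    v ∈ commonKernel structureMatrix ell23 (gPro b) p ↔
      (inner ℝ p v = 0 ∧ inner ℝ (hodgeStar p) v = 0) ∧ v 3 = 0 ∧
        b * (conj (coordU p) * coordU v).re + p 2 * v 2 = 0 := by
  simp [commonKernel, Submodule.mem_inf, mem_charSpace_iff hp, fderiv_ell23_apply,
    fderiv_gPro_apply, and_assoc]

theorem linearisation_mem_commonKernel (hp : p ∈ phaseSpace) {s t : ℝ}
    (hcrit : hamVF structureMatrix (comb ell23 (gPro b) s t) p = 0) (v : Vec 6) :
    linearisation structureMatrix ell23 (gPro b) p s t v ∈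
      commonKernel structureMatrix ell23 (gPro b) p := by
  have hdiff := differentiable_hamVF_comb b s t p
  refine ⟨⟨?_, ?_⟩, ?_⟩
  · refine (mem_charSpace_iff hp).2 (fderiv_casimirs_eq_zero_iff.1 ?_)
    refine fderiv_fderiv_apply_eq_zero
      ((contDiff_casimirs.fderiv_right le_rfl).differentiable one_ne_zero p) hdiff
      (fun q => fderiv_casimirs_eq_zero_iff.2 ?_) hcrit v
    exact ⟨inner_toEuclideanLin_structureMatrix q _,
      inner_hodgeStar_toEuclideanLin_structureMatrix q _⟩
  · refine fderiv_fderiv_apply_eq_zero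
      ((contDiff_ell23.fderiv_right le_rfl).differentiable one_ne_zero p) hdiff
      (fun q => ?_) hcrit v
    rw [fderiv_ell23_apply, hamVF_comb, ofCoords_apply_three]
  · refine fderiv_fderiv_apply_eq_zero
      (((contDiff_gPro b).fderiv_right le_rfl).differentiable one_ne_zero p) hdiff
      (fun q => ?_) hcrit v
    rw [fderiv_gPro_apply, hamVF_comb]
    simp
    ring

theorem hamVF_ell23_eq_zero_iff :
    hamVF structureMatrix ell23 p = 0 ↔ coordU p = 0 ∧ coordW p = 0 := by
  simp [hamVF_ell23, ofCoords_eq_zero_iff]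

theorem hamVF_gPro_eq_smul_iff {c : ℝ} :
    hamVF structureMatrix (gPro b) p = c • hamVF structureMatrix ell23 p ↔
      2 * (p 2 * coordW p - Complex.I * b * p 3 * coordU p) = c * (Complex.I * coordU p) ∧
        b * (conj (coordU p) * coordW p).re = 0 ∧
        2 * (b - 1) * p 2 * coordU p = c * (Complex.I * coordW p) := by
  rw [hamVF_gPro, hamVF_ell23, ← map_smul, ← sub_eq_zero, ← map_sub]
  simp [ofCoords_eq_zero_iff, sub_eq_zero]

theorem conj_coordU_mul_coordW (hp : p ∈ phaseSpace)
    (h : (conj (coordU p) * coordW p).re = 0) :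
    conj (coordU p) * coordW p = -(Complex.I * p 2 * p 3) := by
  refine Complex.ext ?_ ?_
  · simpa using h
  · simpa using eq_neg_of_add_eq_zero_left (mem_phaseSpace_iff_coords.1 hp).2

theorem coordU_eq_zero_of_hamVF_gPro_eq_smul (hb : 1 < b) (hp : p ∈ phaseSpace) {c : ℝ}
    (hc : hamVF structureMatrix (gPro b) p = c • hamVF structureMatrix ell23 p) (hx : p 2 ≠ 0) :
    coordU p = 0 := by
  have hb₀ : b ≠ 0 := (zero_lt_one.trans hb).ne'
  obtain ⟨hu, hre, hw⟩ := hamVF_gPro_eq_smul_iff.1 hc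
  have huw := conj_coordU_mul_coordW hp ((mul_eq_zero_iff_left hb₀).1 hre)
  have hnormSq : conj (coordU p) * coordU p = (‖coordU p‖ : ℂ) ^ 2 := Complex.conj_mul' _
  have hu' : -(2 * p 3 * (p 2 ^ 2 + b * ‖coordU p‖ ^ 2)) = c * ‖coordU p‖ ^ 2 := by
    apply Complex.ofReal_injective
    refine mul_left_cancel₀ Complex.I_ne_zero ?_
    push_cast
    linear_combination conj (coordU p) * hu - 2 * p 2 * huw
      + (2 * Complex.I * b * p 3 + c * Complex.I) * hnormSq
  have hw' : 2 * (b - 1) * ‖coordU p‖ ^ 2 = c * p 3 := by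
    apply Complex.ofReal_injective
    refine mul_left_cancel₀ (Complex.ofReal_ne_zero.2 hx) ?_
    push_cast
    linear_combination conj (coordU p) * hw + c * Complex.I * huw - c * p 2 * p 3 * Complex.I_sq
      - 2 * (b - 1) * p 2 * hnormSq
  have hsum : (b - 1) * (‖coordU p‖ ^ 2) ^ 2 + p 3 ^ 2 * (p 2 ^ 2 + b * ‖coordU p‖ ^ 2) = 0 := by
    linear_combination ‖coordU p‖ ^ 2 / 2 * hw' - p 3 / 2 * hu'
  have hb' : 0 < b - 1 := sub_pos.2 hb
  have := (add_eq_zero_iff_of_nonneg (by positivity) (by positivity)).1 hsum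
  simpa [hb'.ne'] using this.1

theorem coords_eq_zero_of_isSingular (hb : 1 < b) (hp : p ∈ phaseSpace)
    (h : IsSingular structureMatrix ell23 (gPro b) p) :
    coordU p = 0 ∧ coordW p = 0 ∨ coordU p = 0 ∧ p 2 = 0 ∨ p 2 = 0 ∧ coordW p = 0 := by
  by_cases hJ : hamVF structureMatrix ell23 p = 0
  · exact Or.inl (hamVF_ell23_eq_zero_iff.1 hJ)
  obtain ⟨c, hc⟩ := h.exists_eq_smul hJ
  obtain ⟨hu, hre, -⟩ := hamVF_gPro_eq_smul_iff.1 hc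
  obtain hx | hx := eq_or_ne (p 2) 0
  · have huw := conj_coordU_mul_coordW hp (by simpa [(zero_lt_one.trans hb).ne'] using hre)
    obtain hu₀ | hw₀ : coordU p = 0 ∨ coordW p = 0 := by simpa [hx] using huw
    exacts [.inr (.inl ⟨hu₀, hx⟩), .inr (.inr ⟨hx, hw₀⟩)]
  · have hu₀ := coordU_eq_zero_of_hamVF_gPro_eq_smul hb hp hc hx
    exact Or.inl ⟨hu₀, by simpa [hu₀, hx] using hu⟩

end SingularPoints

section SingularTypes

variable {b : ℝ} {p v : Vec 6}

theorem exists_eq_mul_I_mul {a z : ℂ} (ha : a ≠ 0) (h : (conj a * z).re = 0) :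
    ∃ r : ℝ, z = r * (Complex.I * a) := by
  have hre : (z / a).re = 0 := by
    have hsum : z.re * a.re + z.im * a.im = 0 := by
      simpa [mul_comm] using h
    rw [Complex.div_re, ← add_div, hsum, zero_div]
  have him : z / a = (z / a).im * Complex.I := Complex.ext (by simpa using hre) (by simp)
  exact ⟨(z / a).im, by rw [← mul_assoc, ← him, div_mul_cancel₀ z ha]⟩

theorem mem_commonKernel_iff_of_coordU_eq_zero (hp : p ∈ phaseSpace) (hu : coordU p = 0)
    (hx : p 2 = 0) :
    v ∈ commonKernel structureMatrix ell23 (gPro b) p ↔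
      (conj (coordW p) * coordW v).re = 0 ∧ (conj (coordW p) * coordU v).im = p 3 * v 2 ∧
        v 3 = 0 := by
  rw [mem_commonKernel_iff hp, inner_eq_coords, inner_hodgeStar_eq_coords]
  simp only [hu, hx, map_zero, zero_mul, Complex.zero_re, Complex.zero_im, mul_zero, zero_add,
    add_zero, and_true, Complex.mul_im, Complex.conj_re, Complex.conj_im]
  constructor
  · rintro ⟨⟨h₁, h₂⟩, hy⟩
    exact ⟨by simpa [hy] using h₁, by linear_combination -h₂, hy⟩
  · rintro ⟨h₁, h₂, hy⟩
    exact ⟨⟨by simpa [hy] using h₁, by linear_combination -h₂⟩, hy⟩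

theorem hamVF_gPro_eq_smul_of_coordU_eq_zero (hu : coordU p = 0) (hx : p 2 = 0) :
    hamVF structureMatrix (gPro b) p = (0 : ℝ) • hamVF structureMatrix ell23 p :=
  hamVF_gPro_eq_smul_iff.2 (by simp [hu, hx])

theorem mem_orbitSpace_iff_of_coordU_eq_zero (hp : p ∈ phaseSpace) (hu : coordU p = 0)
    (hx : p 2 = 0) (hw : coordW p ≠ 0) (hv : v ∈ commonKernel structureMatrix ell23 (gPro b) p) :
    v ∈ orbitSpace structureMatrix ell23 (gPro b) p ↔
      (conj (coordW p) * coordU v).re = 0 ∧ v 2 = 0 := by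
  rw [orbitSpace_eq_span (hamVF_gPro_eq_smul_of_coordU_eq_zero hu hx),
    Submodule.mem_span_singleton]
  constructor
  · rintro ⟨c, rfl⟩
    simp [hamVF_ell23, hu]
  · rintro ⟨hre, hδx⟩
    obtain ⟨hδw, him, hδy⟩ := (mem_commonKernel_iff_of_coordU_eq_zero hp hu hx).1 hv
    obtain ⟨r, hr⟩ := exists_eq_mul_I_mul hw hδw
    have hδu : coordU v = 0 := by
      have : conj (coordW p) * coordU v = 0 := Complex.ext hre (by rw [him, hδx, mul_zero]; rfl)
      simpa [hw] using this
    refine ⟨r, ext_coords ?_ ?_ ?_ ?_⟩ <;> simp [hamVF_ell23, hu, hδu, hδx, hδy, hr]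

theorem linearisation_reduced_of_coordU_eq_zero (hp : p ∈ phaseSpace) (hu : coordU p = 0)
    (hx : p 2 = 0) (hv : v ∈ commonKernel structureMatrix ell23 (gPro b) p) (t : ℝ) :
    (conj (coordW p) * coordU (linearisation structureMatrix ell23 (gPro b) p 0 t v)).re =
        t * (2 * (b * p 3 ^ 2 + ‖coordW p‖ ^ 2)) * v 2 ∧
      linearisation structureMatrix ell23 (gPro b) p 0 t v 2 =
        -(t * (2 * b) * (conj (coordW p) * coordU v).re) := by
  obtain ⟨-, him, hδy⟩ := (mem_commonKernel_iff_of_coordU_eq_zero hp hu hx).1 hv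
  rw [linearisation_apply, coordU_ofCoords, ofCoords_apply_two, hu, hx, hδy]
  constructor
  · have hfactor : conj (coordW p) * (Complex.I * (((0 : ℝ) - 2 * t * b * p 3) * coordU v
        - 2 * t * b * (0 : ℝ) * 0) + 2 * t * ((0 : ℝ) * coordW v + v 2 * coordW p)) =
        (-(2 * t * b * p 3) : ℝ) * (Complex.I * (conj (coordW p) * coordU v))
          + (2 * t * v 2 * ‖coordW p‖ ^ 2 : ℝ) := by
      push_cast
      linear_combination 2 * t * v 2 * Complex.conj_mul' (coordW p)
    rw [hfactor, Complex.add_re, Complex.re_ofReal_mul, Complex.I_mul_re, Complex.ofReal_re, him]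
    ring
  · simp
    ring

theorem isEllipticPoint_of_coordU_eq_zero (hb : 0 < b) (hp : p ∈ phaseSpace) (hu : coordU p = 0)
    (hx : p 2 = 0) (hw : coordW p ≠ 0) :
    IsEllipticPoint structureMatrix ell23 (gPro b) p := by
  have hXJ : hamVF structureMatrix ell23 p ≠ 0 := by simp [hamVF_ell23_eq_zero_iff, hw]
  have crit_iff (s t : ℝ) : hamVF structureMatrix (comb ell23 (gPro b) s t) p = 0 ↔ s = 0 := by
    simp [hamVF_comb, ofCoords_eq_zero_iff, hu, hx, hw]
  refine isEllipticPoint_of_oscillator (m := 2 * (b * p 3 ^ 2 + ‖coordW p‖ ^ 2)) (k := 2 * b)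
    (f := Complex.reLm ∘ₗ LinearMap.mulLeft ℝ (conj (coordW p)) ∘ₗ coordU.toLinearMap)
    (g := (EuclideanSpace.proj 2 : Vec 6 →L[ℝ] ℝ).toLinearMap) (s := 0) (by positivity)
    (by positivity) (rank_eq_one hXJ (hamVF_gPro_eq_smul_of_coordU_eq_zero hu hx))
    (fun v hv => mem_orbitSpace_iff_of_coordU_eq_zero hp hu hx hw hv) (fun α β => ?_)
    (fun s t hcrit v _ => linearisation_mem_commonKernel hp hcrit v) (fun s t hcrit v hv => ?_)
    (fun s => (crit_iff s 0).1) ((crit_iff 0 1).2 rfl)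
  · obtain ⟨z, hz⟩ : ∃ z, conj (coordW p) * z = α + p 3 * β * Complex.I :=
      ⟨_, mul_div_cancel₀ _ (by simpa using hw)⟩
    refine ⟨ofCoords (z, β, 0, 0), ?_, ?_, rfl⟩
    · rw [mem_commonKernel_iff_of_coordU_eq_zero hp hu hx, coordU_ofCoords, hz]
      simp
    · change (conj (coordW p) * z).re = α
      simp [hz]
  · obtain rfl := (crit_iff s t).1 hcrit
    exact linearisation_reduced_of_coordU_eq_zero hp hu hx hv t

theorem mem_commonKernel_iff_of_coordW_eq_zero (hb : b ≠ 0) (hp : p ∈ phaseSpace) (hx : p 2 = 0)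
    (hw : coordW p = 0) :
    v ∈ commonKernel structureMatrix ell23 (gPro b) p ↔
      (conj (coordU p) * coordU v).re = 0 ∧ (conj (coordU p) * coordW v).im = -(p 3 * v 2) ∧
        v 3 = 0 := by
  rw [mem_commonKernel_iff hp, inner_eq_coords, inner_hodgeStar_eq_coords]
  simp only [hw, hx, map_zero, zero_mul, Complex.zero_re, Complex.zero_im, mul_zero, add_zero,
    mul_eq_zero_iff_left hb, eq_neg_iff_add_eq_zero]
  constructor
  · rintro ⟨⟨-, h⟩, hy, hre⟩
    exact ⟨hre, h, hy⟩
  · rintro ⟨hre, h, hy⟩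
    exact ⟨⟨by simp [hre, hy], h⟩, hy, hre⟩

theorem hamVF_gPro_eq_smul_of_coordW_eq_zero (hx : p 2 = 0) (hw : coordW p = 0) :
    hamVF structureMatrix (gPro b) p =
      (-(2 * b * p 3)) • hamVF structureMatrix ell23 p := by
  refine hamVF_gPro_eq_smul_iff.2 ⟨?_, by simp [hw], by simp [hx, hw]⟩
  rw [hw]
  push_cast
  ring

theorem mem_orbitSpace_iff_of_coordW_eq_zero (hb : b ≠ 0) (hp : p ∈ phaseSpace)
    (hu : coordU p ≠ 0) (hx : p 2 = 0) (hw : coordW p = 0)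
    (hv : v ∈ commonKernel structureMatrix ell23 (gPro b) p) :
    v ∈ orbitSpace structureMatrix ell23 (gPro b) p ↔
      (conj (coordU p) * coordW v).re = 0 ∧ v 2 = 0 := by
  rw [orbitSpace_eq_span (hamVF_gPro_eq_smul_of_coordW_eq_zero hx hw),
    Submodule.mem_span_singleton]
  constructor
  · rintro ⟨c, rfl⟩
    simp [hamVF_ell23, hw]
  · rintro ⟨hre, hδx⟩
    obtain ⟨hδu, him, hδy⟩ := (mem_commonKernel_iff_of_coordW_eq_zero hb hp hx hw).1 hv
    obtain ⟨r, hr⟩ := exists_eq_mul_I_mul hu hδu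
    have hδw : coordW v = 0 := by
      have : conj (coordU p) * coordW v = 0 :=
        Complex.ext hre (by rw [him, hδx, mul_zero, neg_zero]; rfl)
      simpa [hu] using this
    refine ⟨r, ext_coords ?_ ?_ ?_ ?_⟩ <;> simp [hamVF_ell23, hw, hδw, hδx, hδy, hr]

theorem linearisation_reduced_of_coordW_eq_zero (hb : b ≠ 0) (hp : p ∈ phaseSpace)
    (hx : p 2 = 0) (hw : coordW p = 0)
    (hv : v ∈ commonKernel structureMatrix ell23 (gPro b) p) (t : ℝ) :
    (conj (coordU p) *
        coordW (linearisation structureMatrix ell23 (gPro b) p (2 * t * b * p 3) t v)).re =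
        t * (2 * (b * p 3 ^ 2 + (b - 1) * ‖coordU p‖ ^ 2)) * v 2 ∧
      linearisation structureMatrix ell23 (gPro b) p (2 * t * b * p 3) t v 2 =
        -(t * (2 * b) * (conj (coordU p) * coordW v).re) := by
  obtain ⟨-, him, -⟩ := (mem_commonKernel_iff_of_coordW_eq_zero hb hp hx hw).1 hv
  rw [linearisation_apply, coordW_ofCoords, ofCoords_apply_two, hw, hx]
  constructor
  · have hfactor : conj (coordU p) * (Complex.I * (2 * t * b * p 3 : ℝ) * coordW v
        + 2 * t * (b - 1) * ((0 : ℝ) * coordU v + v 2 * coordU p)) =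
        (2 * t * b * p 3 : ℝ) * (Complex.I * (conj (coordU p) * coordW v))
          + (2 * t * (b - 1) * v 2 * ‖coordU p‖ ^ 2 : ℝ) := by
      push_cast
      linear_combination 2 * t * (b - 1) * v 2 * Complex.conj_mul' (coordU p)
    rw [hfactor, Complex.add_re, Complex.re_ofReal_mul, Complex.I_mul_re, Complex.ofReal_re, him]
    ring
  · simp only [map_zero, mul_zero, zero_add, Complex.mul_re, Complex.conj_re, Complex.conj_im]
    ring

theorem isEllipticPoint_of_coordW_eq_zero (hb : 1 < b) (hp : p ∈ phaseSpace) (hu : coordU p ≠ 0)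
    (hx : p 2 = 0) (hw : coordW p = 0) :
    IsEllipticPoint structureMatrix ell23 (gPro b) p := by
  have hb₀ : b ≠ 0 := (zero_lt_one.trans hb).ne'
  have hXJ : hamVF structureMatrix ell23 p ≠ 0 := by simp [hamVF_ell23_eq_zero_iff, hu]
  have crit_iff (s t : ℝ) :
      hamVF structureMatrix (comb ell23 (gPro b) s t) p = 0 ↔ s = 2 * t * b * p 3 := by
    have hcast : (s : ℂ) - 2 * t * b * p 3 = (s - 2 * t * b * p 3 : ℝ) := by push_cast; rfl
    rw [hamVF_comb, hcast, ofCoords_eq_zero_iff]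
    simp [-Complex.ofReal_sub, hu, hx, hw, sub_eq_zero]
  refine isEllipticPoint_of_oscillator (m := 2 * (b * p 3 ^ 2 + (b - 1) * ‖coordU p‖ ^ 2))
    (k := 2 * b)
    (f := Complex.reLm ∘ₗ LinearMap.mulLeft ℝ (conj (coordU p)) ∘ₗ coordW.toLinearMap)
    (g := (EuclideanSpace.proj 2 : Vec 6 →L[ℝ] ℝ).toLinearMap) (s := 2 * 1 * b * p 3)
    (by positivity) (by positivity)
    (rank_eq_one hXJ (hamVF_gPro_eq_smul_of_coordW_eq_zero hx hw))
    (fun v hv => mem_orbitSpace_iff_of_coordW_eq_zero hb₀ hp hu hx hw hv) (fun α β => ?_)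
    (fun s t hcrit v _ => linearisation_mem_commonKernel hp hcrit v) (fun s t hcrit v hv => ?_)
    (fun s hcrit => by simpa using (crit_iff s 0).1 hcrit) ((crit_iff _ 1).2 rfl)
  · obtain ⟨z, hz⟩ : ∃ z, conj (coordU p) * z = α - p 3 * β * Complex.I :=
      ⟨_, mul_div_cancel₀ _ (by simpa using hu)⟩
    refine ⟨ofCoords (0, β, 0, z), ?_, ?_, rfl⟩
    · rw [mem_commonKernel_iff_of_coordW_eq_zero hb₀ hp hx hw, coordW_ofCoords, hz]
      simp
    · change (conj (coordU p) * z).re = α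
      simp [hz]
  · obtain rfl := (crit_iff s t).1 hcrit
    exact linearisation_reduced_of_coordW_eq_zero hb₀ hp hx hw hv t

/-- The coordinates `(δu, δw)` on `K / L` at a common zero of the Hamiltonian vector fields. -/
noncomputable def transverseCoords : Vec 6 →ₗ[ℝ] Fin 2 → ℂ :=
  LinearMap.pi ![coordU.toLinearMap, coordW.toLinearMap]

theorem transverseCoords_apply (v : Vec 6) : transverseCoords v = ![coordU v, coordW v] := by
  ext i
  fin_cases i <;> rfl

theorem hamVF_eq_zero_of_fixed (hu : coordU p = 0) (hw : coordW p = 0) (s t : ℝ) :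
    hamVF structureMatrix (comb ell23 (gPro b) s t) p = 0 := by
  simp [hamVF_comb, ofCoords_eq_zero_iff, hu, hw]

theorem orbitSpace_eq_bot_of_fixed (hu : coordU p = 0) (hw : coordW p = 0) :
    orbitSpace structureMatrix ell23 (gPro b) p = ⊥ := by
  simp [orbitSpace_eq_bot_iff, hamVF_ell23, hamVF_gPro, ofCoords_eq_zero_iff, hu, hw]

theorem rank_eq_zero_iff_coords :
    rank structureMatrix ell23 (gPro b) p = 0 ↔ coordU p = 0 ∧ coordW p = 0 := by
  rw [rank_eq_zero_iff, hamVF_ell23_eq_zero_iff, and_iff_left_iff_imp]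
  rintro ⟨hu, hw⟩
  simp [hamVF_gPro, ofCoords_eq_zero_iff, hu, hw]

theorem mem_commonKernel_iff_of_fixed (hp : p ∈ phaseSpace) (hu : coordU p = 0)
    (hw : coordW p = 0) :
    v ∈ commonKernel structureMatrix ell23 (gPro b) p ↔ v 2 = 0 ∧ v 3 = 0 := by
  have hsphere : p 2 ^ 2 + p 3 ^ 2 = 1 := by
    simpa [hu, hw] using (mem_phaseSpace_iff_coords.1 hp).1
  rw [mem_commonKernel_iff hp, inner_eq_coords, inner_hodgeStar_eq_coords]
  simp only [hu, hw, map_zero, zero_mul, mul_zero, Complex.zero_re, Complex.zero_im, zero_add,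
    add_zero]
  constructor
  · rintro ⟨⟨-, hstar⟩, hy, hx⟩
    refine ⟨?_, hy⟩
    linear_combination -v 2 * hsphere + p 2 * hx + p 3 * hstar - p 2 * p 3 * hy
  · rintro ⟨h₂, h₃⟩
    simp [h₂, h₃]

/-- The matrix in the coordinates `(δu, δw)` of the linearisation of the Hamiltonian vector field of
`s ℓ₂₃ + t G_pro` at a common zero of the Hamiltonian vector fields. -/
noncomputable def transverseMatrix (b : ℝ) (p : Vec 6) (s t : ℝ) : Matrix (Fin 2) (Fin 2) ℂ :=
  !![Complex.I * (s - 2 * t * b * p 3), 2 * t * p 2; 2 * t * (b - 1) * p 2, Complex.I * s]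

theorem transverseCoords_linearisation (hp : p ∈ phaseSpace) (hu : coordU p = 0)
    (hw : coordW p = 0) (hv : v ∈ commonKernel structureMatrix ell23 (gPro b) p) (s t : ℝ) :
    transverseCoords (linearisation structureMatrix ell23 (gPro b) p s t v) =
      (transverseMatrix b p s t).mulVec (transverseCoords v) := by
  obtain ⟨h₂, h₃⟩ := (mem_commonKernel_iff_of_fixed hp hu hw).1 hv
  rw [linearisation_apply, transverseCoords_apply, transverseCoords_apply, coordU_ofCoords,
    coordW_ofCoords, hu, hw, h₂, h₃, transverseMatrix]
  ext i
  fin_cases i <;> simp [Matrix.mulVec, dotProduct, Fin.sum_univ_two] <;> ring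

theorem isTransverseDiagonalisation_of_fixed (hp : p ∈ phaseSpace) (hu : coordU p = 0)
    (hw : coordW p = 0) {M : Matrix (Fin 2) (Fin 2) ℂ} (hM : IsUnit M) {μ : ℝ → ℝ → Fin 2 → ℂ}
    (hμ : ∀ s t, M * transverseMatrix b p s t = Matrix.diagonal (μ s t) * M) :
    IsTransverseDiagonalisation structureMatrix ell23 (gPro b) p
      (M.mulVecLin.restrictScalars ℝ ∘ₗ transverseCoords) μ where
  mem_orbitSpace_iff v hv := by
    obtain ⟨h₂, h₃⟩ := (mem_commonKernel_iff_of_fixed hp hu hw).1 hv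
    have hker : M.mulVec (transverseCoords v) = 0 ↔ transverseCoords v = 0 :=
      map_eq_zero_iff M.mulVecLin (Matrix.mulVec_injective_of_isUnit hM)
    change _ ↔ M.mulVec (transverseCoords v) = 0
    rw [hker, orbitSpace_eq_bot_of_fixed hu hw, Submodule.mem_bot, ← ofCoords_coords v,
      ofCoords_eq_zero_iff, transverseCoords_apply]
    simp [h₂, h₃]
  exists_eq c := by
    obtain ⟨d, rfl⟩ := Matrix.mulVec_surjective_iff_isUnit.2 hM c
    refine ⟨ofCoords (d 0, 0, 0, d 1), (mem_commonKernel_iff_of_fixed hp hu hw).2 ⟨rfl, rfl⟩, ?_⟩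
    have hd : transverseCoords (ofCoords (d 0, 0, 0, d 1)) = d := by
      ext i
      fin_cases i <;> rfl
    exact congrArg M.mulVec hd
  linearisation_mem s t hcrit v _ := linearisation_mem_commonKernel hp hcrit v
  map_linearisation s t _ v hv := by
    change M.mulVec (transverseCoords _) = μ s t * M.mulVec (transverseCoords v)
    rw [transverseCoords_linearisation hp hu hw hv, Matrix.mulVec_mulVec, hμ,
      ← Matrix.mulVec_mulVec]
    exact funext fun j => Matrix.mulVec_diagonal _ _ j

theorem exists_isTransverseDiagonalisation_elliptic (hp : p ∈ phaseSpace) (hu : coordU p = 0)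
    (hw : coordW p = 0) (hx : p 2 = 0) :
    ∃ F, IsTransverseDiagonalisation structureMatrix ell23 (gPro b) p F
      fun s t => ![⟨0, s - 2 * t * b * p 3⟩, ⟨0, s⟩] := by
  refine ⟨_, isTransverseDiagonalisation_of_fixed hp hu hw isUnit_one fun s t => ?_⟩
  ext i j
  fin_cases i <;> fin_cases j <;> simp [transverseMatrix, hx, Complex.ext_iff]

theorem exists_isTransverseDiagonalisation_focusFocus (hb : 1 < b) (hp : p ∈ phaseSpace)
    (hu : coordU p = 0) (hw : coordW p = 0) (hy : p 3 = 0) :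
    ∃ F, IsTransverseDiagonalisation structureMatrix ell23 (gPro b) p F
      fun s t => ![⟨2 * t * p 2 * √(b - 1), s⟩, ⟨-(2 * t * p 2 * √(b - 1)), s⟩] := by
  set k := √(b - 1)
  have hk : 0 < k := Real.sqrt_pos.2 (sub_pos.2 hb)
  have hk₂ : (b : ℂ) - 1 = k ^ 2 := by exact_mod_cast (Real.sq_sqrt (sub_pos.2 hb).le).symm
  refine ⟨_, isTransverseDiagonalisation_of_fixed hp hu hw (M := !![(k : ℂ), 1; -k, 1]) ?_
    fun s t => ?_⟩
  · rw [Matrix.isUnit_iff_isUnit_det, Matrix.det_fin_two_of, isUnit_iff_ne_zero]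
    simpa [← two_mul] using hk.ne'
  · rw [transverseMatrix, hy, hk₂]
    ext i j
    fin_cases i <;> fin_cases j <;>
      simp [Matrix.mul_apply, Fin.sum_univ_two, Complex.mk_eq_add_mul_I] <;> ring

theorem isEllipticPoint_of_fixed (hb : 0 < b) (hp : p ∈ phaseSpace) (hu : coordU p = 0)
    (hw : coordW p = 0) (hx : p 2 = 0) :
    IsEllipticPoint structureMatrix ell23 (gPro b) p := by
  have hy : p 3 ^ 2 = 1 := by simpa [hu, hw, hx] using (mem_phaseSpace_iff_coords.1 hp).1
  have hy₀ : p 3 ≠ 0 := fun h => by simp [h] at hy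
  obtain ⟨F, hF⟩ := exists_isTransverseDiagonalisation_elliptic (b := b) hp hu hw hx
  have hμ : 1 - 2 * (-p 3 / (2 * b)) * b * p 3 = 2 := by
    field_simp
    linear_combination hy
  refine hF.isEllipticPoint (s := 1) (t := -p 3 / (2 * b))
    (by simp [rank_eq_zero_iff_coords.2 ⟨hu, hw⟩]) (fun s t _ h => ?_)
    (hamVF_eq_zero_of_fixed hu hw _ _) (injective_sumElim_conj ?_ ?_) ?_
  · obtain ⟨h₀, rfl⟩ : s - 2 * t * b * p 3 = 0 ∧ s = 0 := by simpa [Complex.ext_iff] using h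
    exact ⟨rfl, by simpa [hb.ne', hy₀] using h₀⟩
  · simp [injective_pair_iff_ne, Complex.ext_iff, hμ]
  · simp [Fin.forall_fin_two, hμ]
  · simp [Fin.forall_fin_two]

theorem isFocusFocusPoint_of_fixed (hb : 1 < b) (hp : p ∈ phaseSpace) (hu : coordU p = 0)
    (hw : coordW p = 0) (hy : p 3 = 0) :
    IsFocusFocusPoint structureMatrix ell23 (gPro b) p := by
  have hx : p 2 ≠ 0 := by
    intro hx
    simpa [hu, hw, hx, hy] using (mem_phaseSpace_iff_coords.1 hp).1
  have hk : √(b - 1) ≠ 0 := (Real.sqrt_pos.2 (sub_pos.2 hb)).ne'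
  have hrank : rank structureMatrix ell23 (gPro b) p = 0 := rank_eq_zero_iff_coords.2 ⟨hu, hw⟩
  have hcrit := hamVF_eq_zero_of_fixed (b := b) hu hw 1 1
  obtain ⟨F, hF⟩ := exists_isTransverseDiagonalisation_focusFocus hb hp hu hw hy
  have hdim : Fintype.card (Fin 2) + rank structureMatrix ell23 (gPro b) p = 2 := by simp [hrank]
  have hα : 2 * 1 * p 2 * √(b - 1) ≠ 0 := by positivity
  have hinj : Function.Injective (Sum.elim _ _) :=
    injective_sumElim_conj (f := ![⟨2 * 1 * p 2 * √(b - 1), 1⟩, ⟨-(2 * 1 * p 2 * √(b - 1)), 1⟩])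
      (by simpa [injective_pair_iff_ne, Complex.ext_iff, self_eq_neg] using hα)
      (by simp [Fin.forall_fin_two])
  refine ⟨hrank, hF.isNondegenerate hdim (fun s t _ h => ?_) hcrit hinj, 1, 1,
    hF.isRegularComb hcrit hdim hinj, 2 * 1 * p 2 * √(b - 1), 1, hα, one_ne_zero, fun z => ?_⟩
  · have h₀ : t = 0 ∧ s = 0 := by simpa [Complex.ext_iff, hx, hk] using h
    exact h₀.symm
  · rw [hF.isTransverseEigenvalue_iff hcrit]
    simp only [Fin.exists_fin_two, Matrix.cons_val_zero, Matrix.cons_val_one, Complex.ext_iff,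
      Complex.conj_re, Complex.conj_im]
    tauto

theorem isFocusFocusPoint_iff (hb : 1 < b) (hp : p ∈ phaseSpace) :
    IsFocusFocusPoint structureMatrix ell23 (gPro b) p ↔
      coordU p = 0 ∧ coordW p = 0 ∧ p 3 = 0 := by
  refine ⟨fun ⟨hrank, _, s, t, hreg, α, β, hα, _, hspectrum⟩ => ?_,
    fun ⟨hu, hw, hy⟩ => isFocusFocusPoint_of_fixed hb hp hu hw hy⟩
  obtain ⟨hu, hw⟩ := rank_eq_zero_iff_coords.1 hrank
  refine ⟨hu, hw, by_contra fun hy => hα ?_⟩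
  have hx : p 2 = 0 := by simpa [hu, hy] using (mem_phaseSpace_iff_coords.1 hp).2
  obtain ⟨F, hF⟩ := exists_isTransverseDiagonalisation_elliptic (b := b) hp hu hw hx
  have heig := (hspectrum ⟨α, β⟩).2 ⟨.inl rfl, .inl rfl⟩
  rw [hF.isTransverseEigenvalue_iff hreg.1, Fin.exists_fin_two] at heig
  obtain (h | h) | (h | h) := heig <;> simpa using congrArg Complex.re h

theorem isNondegenerate_and_isEllipticPoint_or_isFocusFocusPoint (hb : 1 < b)
    (hp : p ∈ phaseSpace) (h : IsSingular structureMatrix ell23 (gPro b) p) :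
    IsNondegenerate structureMatrix ell23 (gPro b) p ∧
      (IsEllipticPoint structureMatrix ell23 (gPro b) p ∨
        IsFocusFocusPoint structureMatrix ell23 (gPro b) p) := by
  have hb₀ : 0 < b := zero_lt_one.trans hb
  suffices IsEllipticPoint structureMatrix ell23 (gPro b) p ∨
      IsFocusFocusPoint structureMatrix ell23 (gPro b) p from
    ⟨this.elim (·.2.1) (·.2.1), this⟩
  by_cases hfixed : coordU p = 0 ∧ coordW p = 0
  · obtain ⟨hu, hw⟩ := hfixed
    obtain hx | hy : p 2 = 0 ∨ p 3 = 0 := by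
      simpa [hu] using (mem_phaseSpace_iff_coords.1 hp).2
    · exact .inl (isEllipticPoint_of_fixed hb₀ hp hu hw hx)
    · exact .inr (isFocusFocusPoint_of_fixed hb hp hu hw hy)
  · obtain h | ⟨hu, hx⟩ | ⟨hx, hw⟩ := coords_eq_zero_of_isSingular hb hp h
    · exact absurd h hfixed
    · exact .inl (isEllipticPoint_of_coordU_eq_zero hb₀ hp hu hx fun hw => hfixed ⟨hu, hw⟩)
    · exact .inl (isEllipticPoint_of_coordW_eq_zero hb hp (fun hu => hfixed ⟨hu, hw⟩) hx hw)

end SingularTypes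

section CircleAction

theorem circle_conj_mul_self (z : Circle) : conj (z : ℂ) * z = 1 := by
  rw [← Circle.coe_inv_eq_conj, ← Circle.coe_mul, inv_mul_cancel, Circle.coe_one]

/-- The action of the circle on `ℝ⁶` by simultaneous rotation of the planes `(ℓ₁₂, ℓ₁₃)` and
`(ℓ₂₄, ℓ₃₄)`, whose orbits are the integral curves of the Hamiltonian vector field of `ℓ₂₃`. -/
noncomputable def rotate (z : Circle) (p : Vec 6) : Vec 6 :=
  ofCoords (z * coordU p, p 2, p 3, z * coordW p)

theorem continuous_rotate : Continuous fun q : Circle × Vec 6 => rotate q.1 q.2 := by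
  unfold rotate
  fun_prop

theorem rotate_one (p : Vec 6) : rotate 1 p = p := by
  simp [rotate, ofCoords_coords]

theorem rotate_mul (z w : Circle) (p : Vec 6) : rotate (z * w) p = rotate z (rotate w p) := by
  simp [rotate, mul_assoc]

theorem rotate_mem_phaseSpace (z : Circle) {p : Vec 6} (hp : p ∈ phaseSpace) :
    rotate z p ∈ phaseSpace := by
  have huw : conj (z * coordU p) * (z * coordW p) = conj (coordU p) * coordW p := by
    rw [map_mul]
    linear_combination conj (coordU p) * coordW p * circle_conj_mul_self z
  rw [mem_phaseSpace_iff_coords] at hp ⊢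
  rw [rotate, coordU_ofCoords, coordW_ofCoords, huw, norm_mul, norm_mul, Circle.norm_coe, one_mul,
    one_mul]
  exact hp

theorem hasDerivAt_rotate (p : Vec 6) (t : ℝ) :
    HasDerivAt (fun s => rotate (Circle.exp s) p)
      (hamVF structureMatrix ell23 (rotate (Circle.exp t) p)) t := by
  have hexp : HasDerivAt (fun s => (Circle.exp s : ℂ)) (Complex.I * Circle.exp t) t := by
    simpa [mul_comm] using ((Complex.ofRealCLM.hasDerivAt (x := t)).mul_const Complex.I).cexp
  rw [hamVF_ell23, rotate, coordU_ofCoords, coordW_ofCoords, ← mul_assoc, ← mul_assoc]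
  exact ofCoords.hasFDerivAt.comp_hasDerivAt t <| (hexp.mul_const _).prodMk <|
    (hasDerivAt_const t _).prodMk <| (hasDerivAt_const t _).prodMk (hexp.mul_const _)

theorem generatesCircleAction_ell23 : GeneratesCircleAction structureMatrix phaseSpace ell23 := by
  refine ⟨fun z p => ⟨rotate z p, rotate_mem_phaseSpace z p.2⟩, ?_,
    fun p => Subtype.ext (rotate_one p), fun z w p => Subtype.ext (rotate_mul z w p),
    fun z hz => ?_, fun p => hasDerivAt_rotate p⟩
  · exact (continuous_rotate.comp (continuous_id.prodMap continuous_subtype_val)).subtype_mk _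
  · have hmem : ofCoords (1, 0, 0, 0) ∈ phaseSpace := by simp [mem_phaseSpace_iff_coords]
    have hfix : rotate z (ofCoords (1, 0, 0, 0)) = _ := congrArg Subtype.val (hz ⟨_, hmem⟩)
    exact Circle.ext (by simpa [rotate] using congrArg coordU hfix)

end CircleAction

section Semitoric

variable {b : ℝ}

theorem hausdorffMeasure_isSingular (hb : 1 < b) :
    μH[(4 : ℝ)] {p ∈ phaseSpace | IsSingular structureMatrix ell23 (gPro b) p} = 0 := by
  refine measure_mono_null (t := Set.range (fun q : ℝ × ℝ => ofCoords (0, q.1, q.2, 0)) ∪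
    (Set.range (fun q : ℝ × ℂ => ofCoords (0, 0, q.1, q.2)) ∪
      Set.range (fun q : ℂ × ℝ => ofCoords (q.1, 0, q.2, 0)))) ?_
    (measure_union_null ?_ (measure_union_null ?_ ?_))
  · rintro p ⟨hp, hs⟩
    obtain ⟨hu, hw⟩ | ⟨hu, hx⟩ | ⟨hx, hw⟩ := coords_eq_zero_of_isSingular hb hp hs
    · exact .inl ⟨(p 2, p 3), ext_coords hu.symm rfl rfl hw.symm⟩
    · exact .inr (.inl ⟨(p 3, coordW p), ext_coords hu.symm hx.symm rfl rfl⟩)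
    · exact .inr (.inr ⟨(coordU p, p 3), ext_coords rfl hx.symm rfl hw.symm⟩)
  all_goals
    exact hausdorffMeasure_range_eq_zero_of_finrank_lt (d := 4) (by fun_prop)
      (by norm_num [Complex.finrank_real_complex])

theorem isIntegrableSystem (hb : 1 < b) :
    IsIntegrableSystem structureMatrix phaseSpace ell23 (gPro b) where
  symplectic := isSymplecticManifold_phaseSpace
  smooth_J := contDiff_ell23
  smooth_H := contDiff_gPro b
  commute p _ := bracket_ell23_gPro b p
  independent := hausdorffMeasure_isSingular hb

theorem isGeneralisedSemitoric (hb : 1 < b) :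
    IsGeneralisedSemitoric structureMatrix phaseSpace ell23 (gPro b) where
  integrable := isIntegrableSystem hb
  proper _ hC :=
    isCompact_phaseSpace.inter_right (hC.isClosed.preimage (contDiff_ell23 (m := 0)).continuous)
  circleAction := generatesCircleAction_ell23
  singularities _ := isNondegenerate_and_isEllipticPoint_or_isFocusFocusPoint hb

end Semitoric

section FocusFocusFibre

theorem exists_circle_mul_eq_of_conj_mul_im_eq_zero {a c : ℂ} (h : (conj a * c).im = 0) :
    ∃ (ζ : Circle) (r : ℝ), a = ‖a‖ * ζ ∧ c = r * ζ := by
  have polar (z : ℂ) : z = ‖z‖ * Circle.exp z.arg := by simp [Complex.norm_mul_exp_arg_mul_I]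
  obtain rfl | ha := eq_or_ne a 0
  · exact ⟨_, _, by simp, polar c⟩
  · refine ⟨Circle.exp a.arg, (conj a * c).re / ‖a‖, polar a, ?_⟩
    have hn : (‖a‖ : ℂ) ≠ 0 := by simpa using ha
    have hre : ((conj a * c).re : ℂ) = conj a * c := Complex.ext rfl (by simpa using h.symm)
    rw [Complex.ofReal_div, hre, div_mul_eq_mul_div, eq_div_iff hn]
    refine mul_left_cancel₀ hn ?_
    linear_combination -c * Complex.conj_mul' a + conj a * c * polar a

theorem circle_re_sq_add_im_sq (z : Circle) : (z : ℂ).re ^ 2 + (z : ℂ).im ^ 2 = 1 := by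
  simpa [Complex.normSq_apply, sq] using Circle.normSq_coe z

theorem exists_circle_re_im {x y : ℝ} (h : x ^ 2 + y ^ 2 = 1) :
    ∃ z : Circle, (z : ℂ).re = x ∧ (z : ℂ).im = y :=
  ⟨⟨⟨x, y⟩, mem_sphere_zero_iff_norm.2 <| by simp [Complex.norm_def, Complex.normSq_mk, ← sq, h]⟩,
    rfl, rfl⟩

theorem circle_sq_eq_one_iff (z : Circle) : z ^ 2 = 1 ↔ (z : ℂ).im = 0 := by
  rw [← Circle.coe_eq_one, Circle.coe_pow, Complex.ext_iff]
  simp only [sq, Complex.mul_re, Complex.mul_im, Complex.one_re, Complex.one_im]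
  constructor
  · rintro ⟨h, -⟩
    nlinarith [circle_re_sq_add_im_sq z]
  · intro h
    have hz := circle_re_sq_add_im_sq z
    rw [h] at hz ⊢
    constructor <;> linarith

theorem mk_mem_pinchPoints_iff (q : Circle × Circle) :
    Quotient.mk pinchSetoid q ∈ pinchPoints ↔ (q.1 : ℂ).im = 0 := by
  rw [← circle_sq_eq_one_iff]
  constructor
  · rintro ⟨z, w, hz, h⟩
    obtain rfl | ⟨-, h⟩ := Quotient.exact h
    exacts [hz, h]
  · intro h
    exact ⟨q.1, q.2, h, rfl⟩

variable {b : ℝ}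

/-- The parametrisation of the fibre over `(0, 1)` by the torus. On this fibre `y = 0`,
`b |u|² + x² = 1` and `w = ± √(b - 1) u`; the first circle carries `x` and the signed size of `w`,
the second one the common direction of `u` and `w`. -/
noncomputable def fibreMap (b : ℝ) (q : Circle × Circle) : Vec 6 :=
  ofCoords (|(q.1 : ℂ).im| / √b * q.2, (q.1 : ℂ).re, 0, √(b - 1) * ((q.1 : ℂ).im / √b) * q.2)

theorem continuous_fibreMap (b : ℝ) : Continuous (fibreMap b) := by
  unfold fibreMap
  fun_prop

theorem mem_fibre_iff {p : Vec 6} :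
    p ∈ phaseSpace ∧ (ell23 p, gPro b p) = ((0 : ℝ), (1 : ℝ)) ↔
      p 3 = 0 ∧ b * ‖coordU p‖ ^ 2 + p 2 ^ 2 = 1 ∧
        ‖coordW p‖ ^ 2 = (b - 1) * ‖coordU p‖ ^ 2 ∧ (conj (coordU p) * coordW p).im = 0 := by
  rw [mem_phaseSpace_iff_coords, Prod.mk.injEq, ell23, gPro_eq]
  constructor
  · rintro ⟨⟨h₁, h₂⟩, hy, h₃⟩
    rw [hy] at h₁ h₂
    exact ⟨hy, h₃, by linarith, by linarith⟩
  · rintro ⟨hy, h₁, h₂, h₃⟩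
    rw [hy]
    exact ⟨⟨by linarith, by linarith⟩, rfl, h₁⟩

theorem fibreMap_mem (hb : 1 < b) (q : Circle × Circle) :
    fibreMap b q ∈ phaseSpace ∧
      (ell23 (fibreMap b q), gPro b (fibreMap b q)) = ((0 : ℝ), (1 : ℝ)) := by
  have hb_sq : √b ^ 2 = b := Real.sq_sqrt (zero_lt_one.trans hb).le
  have hk_sq : √(b - 1) ^ 2 = b - 1 := Real.sq_sqrt (sub_pos.2 hb).le
  obtain ⟨z, ζ⟩ := q
  have hu : ‖coordU (fibreMap b (z, ζ))‖ ^ 2 = (z : ℂ).im ^ 2 / b := by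
    simp [fibreMap, Circle.norm_coe, div_pow, hb_sq]
  have hw : ‖coordW (fibreMap b (z, ζ))‖ ^ 2 = (b - 1) * ((z : ℂ).im ^ 2 / b) := by
    simp [fibreMap, Circle.norm_coe, mul_pow, div_pow, hb_sq, hk_sq]
  have huw : conj (coordU (fibreMap b (z, ζ))) * coordW (fibreMap b (z, ζ)) =
      (|(z : ℂ).im| / √b * (√(b - 1) * ((z : ℂ).im / √b)) : ℝ) := by
    rw [fibreMap, coordU_ofCoords, coordW_ofCoords]
    push_cast
    simp only [map_mul, map_div₀, Complex.conj_ofReal]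
    linear_combination ((|(z : ℂ).im| : ℝ) : ℂ) / √b * (√(b - 1) * ((z : ℂ).im / √b)) *
      circle_conj_mul_self ζ
  refine mem_fibre_iff.2 ⟨rfl, ?_, by rw [hw, hu], by rw [huw, Complex.ofReal_im]⟩
  rw [hu, mul_div_cancel₀ _ (zero_lt_one.trans hb).ne', add_comm]
  exact circle_re_sq_add_im_sq z

theorem fibreMap_eq_of_pinchSetoid {x y : Circle × Circle} (h : pinchSetoid x y) :
    fibreMap b x = fibreMap b y := by
  obtain rfl | ⟨h₁, h₂⟩ := h
  · rfl
  · have him : (x.1 : ℂ).im = 0 := (circle_sq_eq_one_iff _).1 h₂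
    simp [fibreMap, ← h₁, him]

theorem pinchSetoid_of_fibreMap_eq (hb : 1 < b) {x y : Circle × Circle}
    (h : fibreMap b x = fibreMap b y) : pinchSetoid x y := by
  obtain ⟨z, ζ⟩ := x
  obtain ⟨z', ζ'⟩ := y
  have hb₀ : √b ≠ 0 := (Real.sqrt_pos.2 (zero_lt_one.trans hb)).ne'
  have hk : √(b - 1) ≠ 0 := (Real.sqrt_pos.2 (sub_pos.2 hb)).ne'
  have hu : (|(z : ℂ).im| / √b * ζ : ℂ) = |(z' : ℂ).im| / √b * ζ' := congrArg coordU h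
  have hw : √(b - 1) * ((z : ℂ).im / √b : ℂ) * ζ = √(b - 1) * ((z' : ℂ).im / √b) * ζ' :=
    congrArg coordW h
  have hre : (z : ℂ).re = (z' : ℂ).re := congrArg (· 2) h
  have habs : |(z : ℂ).im| = |(z' : ℂ).im| := by
    simpa [Circle.norm_coe, hb₀] using congrArg norm hu
  by_cases him : (z : ℂ).im = 0
  · have him' : (z' : ℂ).im = 0 := by simpa [him, eq_comm] using habs
    exact .inr ⟨Circle.ext (Complex.ext hre (him.trans him'.symm)),
      (circle_sq_eq_one_iff z).2 him⟩
  · have hζ : ζ = ζ' := by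
      rw [← habs] at hu
      exact Circle.ext (mul_left_cancel₀ (by simp [him, hb₀]) hu)
    have him' : (z : ℂ).im = (z' : ℂ).im := by simpa [hζ, hk, hb₀] using hw
    exact .inl (Prod.ext (Circle.ext (Complex.ext hre him')) hζ)

theorem exists_fibreMap_eq (hb : 1 < b) {p : Vec 6}
    (hp : p ∈ phaseSpace ∧ (ell23 p, gPro b p) = ((0 : ℝ), (1 : ℝ))) :
    ∃ q, fibreMap b q = p := by
  obtain ⟨hy, hux, hnorm, him⟩ := mem_fibre_iff.1 hp
  obtain ⟨ζ, r, hu, hw⟩ := exists_circle_mul_eq_of_conj_mul_im_eq_zero him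
  have hb₀ : 0 < √b := Real.sqrt_pos.2 (zero_lt_one.trans hb)
  have hb_sq : √b ^ 2 = b := Real.sq_sqrt (zero_lt_one.trans hb).le
  have hk : 0 < √(b - 1) := Real.sqrt_pos.2 (sub_pos.2 hb)
  have hk_sq : √(b - 1) ^ 2 = b - 1 := Real.sq_sqrt (sub_pos.2 hb).le
  have hr : |r| = √(b - 1) * ‖coordU p‖ := by
    rw [hw, norm_mul, Circle.norm_coe, mul_one, Complex.norm_real, Real.norm_eq_abs, ← hk_sq,
      ← mul_pow] at hnorm
    exact (sq_eq_sq₀ (abs_nonneg r) (by positivity)).1 hnorm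
  obtain ⟨z, hre, him⟩ := exists_circle_re_im (x := p 2) (y := √b * (r / √(b - 1))) <| by
    rw [mul_pow, hb_sq, div_pow, ← sq_abs r, hr, mul_pow, mul_div_cancel_left₀ _ (by positivity)]
    linarith
  refine ⟨(z, ζ), ext_coords ?_ hre hy.symm ?_⟩
  · rw [hu, fibreMap, coordU_ofCoords, him, abs_mul, abs_div, hr, abs_of_pos hb₀, abs_of_pos hk,
      mul_div_cancel_left₀ _ hk.ne', ← Complex.ofReal_div, mul_div_cancel_left₀ _ hb₀.ne']
  · rw [hw, fibreMap, coordW_ofCoords, him, ← Complex.ofReal_div, mul_div_cancel_left₀ _ hb₀.ne',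
      ← Complex.ofReal_mul, mul_div_cancel₀ _ hk.ne']

/-- The homeomorphism of the doubly pinched torus onto the fibre over `(0, 1)` which is induced by
`fibreMap`. -/
noncomputable def fibreHomeomorph (hb : 1 < b) : DoublyPinchedTorus ≃ₜ
    {p : Vec 6 // p ∈ phaseSpace ∧ (ell23 p, gPro b p) = ((0 : ℝ), (1 : ℝ))} :=
  Continuous.homeoOfEquivCompactToT2 (f := Equiv.ofBijective
    (Quotient.lift (fun q => ⟨fibreMap b q, fibreMap_mem hb q⟩)
      fun _ _ h => Subtype.ext (fibreMap_eq_of_pinchSetoid h))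
    ⟨by
      rintro ⟨x⟩ ⟨y⟩ h
      exact Quotient.sound (pinchSetoid_of_fibreMap_eq hb (congrArg Subtype.val h)),
    fun p => by
      obtain ⟨q, hq⟩ := exists_fibreMap_eq hb p.2
      exact ⟨Quotient.mk _ q, Subtype.ext hq⟩⟩)
    (((continuous_fibreMap b).subtype_mk _).quotient_lift _)

theorem isFocusFocusPoint_fibreMap_iff (hb : 1 < b) (q : Circle × Circle) :
    IsFocusFocusPoint structureMatrix ell23 (gPro b) (fibreMap b q) ↔ (q.1 : ℂ).im = 0 := by
  have hb₀ : √b ≠ 0 := (Real.sqrt_pos.2 (zero_lt_one.trans hb)).ne'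
  rw [isFocusFocusPoint_iff hb (fibreMap_mem hb q).1]
  simp +contextual [fibreMap, hb₀]

theorem isFocusFocusPoint_fibreHomeomorph_iff (hb : 1 < b) (q : DoublyPinchedTorus) :
    IsFocusFocusPoint structureMatrix ell23 (gPro b) (fibreHomeomorph hb q : Vec 6) ↔
      q ∈ pinchPoints := by
  obtain ⟨q⟩ := q
  exact (isFocusFocusPoint_fibreMap_iff hb q).trans (mk_mem_pinchPoints_iff q).symm

theorem focusFocus_values (hb : 1 < b) :
    {c : ℝ × ℝ | ∃ p ∈ phaseSpace, IsFocusFocusPoint structureMatrix ell23 (gPro b) p ∧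
      (ell23 p, gPro b p) = c} = {((0 : ℝ), (1 : ℝ))} := by
  ext c
  constructor
  · rintro ⟨p, hp, hff, rfl⟩
    obtain ⟨hu, hw, hy⟩ := (isFocusFocusPoint_iff hb hp).1 hff
    simpa [ell23, gPro_eq, hu, hw, hy] using (mem_phaseSpace_iff_coords.1 hp).1
  · rintro rfl
    obtain ⟨hmem, hvalue⟩ := fibreMap_mem hb (1, 1)
    exact ⟨_, hmem, (isFocusFocusPoint_fibreMap_iff hb _).2 (by simp), hvalue⟩

end FocusFocusFibre

end Prolate

theorem mainTheorem7 (b : ℝ) (hb : 1 < b) :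
    PoissonSystem.GeneratesCircleAction Prolate.structureMatrix Prolate.phaseSpace Prolate.ell23 ∧
    (∀ p ∈ Prolate.phaseSpace,
      PoissonSystem.IsSingular Prolate.structureMatrix Prolate.ell23 (Prolate.gPro b) p →
        PoissonSystem.IsNondegenerate Prolate.structureMatrix Prolate.ell23 (Prolate.gPro b) p ∧
        (PoissonSystem.IsEllipticPoint Prolate.structureMatrix Prolate.ell23 (Prolate.gPro b) p ∨
          PoissonSystem.IsFocusFocusPoint
            Prolate.structureMatrix Prolate.ell23 (Prolate.gPro b) p)) ∧
    {c : ℝ × ℝ | ∃ p ∈ Prolate.phaseSpace,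
      PoissonSystem.IsFocusFocusPoint Prolate.structureMatrix Prolate.ell23 (Prolate.gPro b) p ∧
        (Prolate.ell23 p, Prolate.gPro b p) = c} = {((0 : ℝ), (1 : ℝ))} ∧
    (∃ e : PoissonSystem.DoublyPinchedTorus ≃ₜ
        {p : PoissonSystem.Vec 6 // p ∈ Prolate.phaseSpace ∧
          (Prolate.ell23 p, Prolate.gPro b p) = ((0 : ℝ), (1 : ℝ))},
      ∀ x, PoissonSystem.IsFocusFocusPoint Prolate.structureMatrix Prolate.ell23 (Prolate.gPro b)
        (e x : PoissonSystem.Vec 6) ↔ x ∈ PoissonSystem.pinchPoints) ∧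
    PoissonSystem.IsGeneralisedSemitoric
      Prolate.structureMatrix Prolate.phaseSpace Prolate.ell23 (Prolate.gPro b) := by
  open PoissonSystem Prolate in
  exact ⟨generatesCircleAction_ell23,
    fun _ => isNondegenerate_and_isEllipticPoint_or_isFocusFocusPoint hb, focusFocus_values hb,
    ⟨fibreHomeomorph hb, isFocusFocusPoint_fibreHomeomorph_iff hb⟩, isGeneralisedSemitoric hb⟩
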